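/- Let $Q\ge 8$ be even, $s>Q/4$, $l=\tfrac12\varphi(Q)-1$ ($\varphi$ is Euler's totient), and $\beta=3(Q-1)$. Let $\mathbf k_j=(\cos\frac{2\pi (j-1)}{Q},\sin\frac{2\pi (j-1)}{Q})$, $1\le j\le Q$, let $\Gamma=\{\sum_{j}m_j\mathbf k_j:\mathbf m\in\mathbb N^Q\}$ be the quasilattice they generate, and for $\mathbf k\in\Gamma$ let $N_{\mathbf k}$ be the least value of $\sum_j m_j$ among all $\mathbf m\in\mathbb N^Q$ with $\mathbf k=\sum_j m_j\mathbf k_j$. Let $\mathcal H_s$ be the space of Fourier series $u=\sum_{\mathbf k\in\Gamma}u_{\mathbf k}e^{i\mathbf k\cdot\mathbf x}$, $u_{\mathbf k}\in\mathbb C$, with $\|u\|_s^2=\sum_{\mathbf k\in\Gamma}(1+N_{\mathbf k}^2)^s|u_{\mathbf k}|^2<\infty$, with the scalar product $\langle u,v\rangle_s=\sum_{\mathbf k\in\Gamma}(1+N_{\mathbf k}^2)^su_{\mathbf k}\overline{v_{\mathbf k}}$. Put $U^{(0)}=\sum_{j=1}^Qe^{i\mathbf k_j\cdot\mathbf x}$.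 The operator $(1+\Delta)^2$ multiplies $e^{i\mathbf k\cdot\mathbf x}$ by $(1-|\mathbf k|^2)^2$, and products are given by convolution of Fourier coefficients. Among the formal power series in $\mu^{1/2}$ with coefficients in $\mathcal H_s$ that are invariant under the rotation by $2\pi/Q$ of the plane, with vanishing constant term and with the coefficient of $\mu^{1/2}$ a positive multiple of $U^{(0)}$, there is exactly one formal solution $U$ of the steady Swift–Hohenberg equation $$(1+\Delta)^2U-\mu U+U^3=0 .$$ It has the form $$U=\sqrt{\frac{\mu}{\beta}}\sum_{n\ge0}\mu^nU^{(n)},\qquad U^{(n)}=\beta^{(n)}U^{(0)}+\widetilde U^{(n)},\qquad \langle\widetilde U^{(n)},e^{i\mathbf k_j\cdot\mathbf x}\rangle_s=0\quad(1\le j\le Q),$$ where $\beta^{(n)}\in\mathbb R$, where each $U^{(n)}\in\mathcal H_s$ is real-valued and invariant under the rotation by $2\pi/Q$, and where the term $n=0$ is the above $U^{(0)}$. Moreover there are constants $c_s>0$ such that $\|uv\|_s\le c_s\|u\|_s\|v\|_s$ for all $u,v\in\mathcal H_s$ (with $uv\in\mathcal H_s$), and for every such $c_s$ there are positive numbers $\delta$,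 $\gamma$ and $K$ (depending only on $Q$, $s$ and $c_s$) with $$\|\widetilde U^{(n)}\|_s\le\delta\,\frac{Q-1}{2^{s/2}c_s^2Q}\,K^n(n!)^{4l}\quad\text{and}\quad|\beta^{(n)}|\le\delta K^n(n!)^{4l}\quad(n\ge1),$$ $$\|U^{(n)}\|_s\le\gamma K^n(n!)^{4l}\quad(n\ge0).$$ -/

import Mathlib

open scoped ComplexConjugate

namespace Quasipattern

noncomputable section

/-- The plane is identified with `ℂ`. The `Q` wavevectors
`(cos (2 π j / Q), sin (2 π j / Q))`, `j = 0, …, Q - 1`. -/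
def waveVec (Q : ℕ) (j : Fin Q) : ℂ :=
  Complex.exp (2 * Real.pi * Complex.I * ((j : ℕ) : ℂ) / (Q : ℂ))

/-- The integer combination `∑ j, m j • k_j`, with `m` a vector of natural numbers. -/
def combo (Q : ℕ) (m : Fin Q → ℕ) : ℂ := ∑ j, (m j : ℂ) * waveVec Q j

/-- The quasilattice generated by the `Q` wavevectors. -/
def quasilattice (Q : ℕ) : AddSubmonoid ℂ where
  carrier := {k | ∃ m : Fin Q → ℕ, k = combo Q m}
  zero_mem' := ⟨0, by simp [combo]⟩
  add_mem' := by
    rintro a b ⟨m, rfl⟩ ⟨n, rfl⟩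
    exact ⟨m + n, by simp [combo, add_mul, Finset.sum_add_distrib]⟩

/-- The order of a point of the quasilattice: the least `|m| = ∑ j, m j` among the
representations `k = ∑ j, m j • k_j`. -/
def order (Q : ℕ) (k : quasilattice Q) : ℕ :=
  sInf {n | ∃ m : Fin Q → ℕ, (k : ℂ) = combo Q m ∧ n = ∑ j, m j}

/-- A formal Fourier series `∑ k, u k * exp (i k · x)` over the quasilattice, given by its
coefficients. -/
abbrev FourierSeries (Q : ℕ) : Type := quasilattice Q → ℂ

/-- The weight `(1 + N_k ^ 2) ^ s`. -/
def weight (Q : ℕ) (s : ℝ) (k : quasilattice Q) : ℝ := (1 + (order Q k : ℝ) ^ 2) ^ s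

/-- Membership in the weighted space `H_s`. -/
def MemH (Q : ℕ) (s : ℝ) (u : FourierSeries Q) : Prop :=
  Summable fun k => weight Q s k * ‖u k‖ ^ 2

/-- The norm of `H_s`. -/
def hNorm (Q : ℕ) (s : ℝ) (u : FourierSeries Q) : ℝ :=
  Real.sqrt (∑' k, weight Q s k * ‖u k‖ ^ 2)

/-- The scalar product of `H_s`. -/
def hInner (Q : ℕ) (s : ℝ) (u v : FourierSeries Q) : ℂ :=
  ∑' k, (weight Q s k : ℂ) * u k * conj (v k)

/-- The product of two functions, on Fourier coefficients:
`(u v)_k = ∑_{p + q = k} u_p v_q`. -/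
def mul {Q : ℕ} (u v : FourierSeries Q) : FourierSeries Q := fun k =>
  ∑' p : {p : quasilattice Q × quasilattice Q // p.1 + p.2 = k}, u p.1.1 * v p.1.2

/-- `C` is a constant for which `‖u v‖_s ≤ C ‖u‖_s ‖v‖_s` holds on the algebra `H_s`. -/
def IsAlgebraConst (Q : ℕ) (s C : ℝ) : Prop :=
  0 < C ∧ ∀ u v : FourierSeries Q, MemH Q s u → MemH Q s v →
    MemH Q s (mul u v) ∧ hNorm Q s (mul u v) ≤ C * hNorm Q s u * hNorm Q s v

/-- The operator `(1 + Δ) ^ 2`, that multiplies `exp (i k · x)` by `(1 - |k| ^ 2) ^ 2`. -/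
def L0 {Q : ℕ} (u : FourierSeries Q) : FourierSeries Q := fun k =>
  (((1 - ‖(k : ℂ)‖ ^ 2) ^ 2 : ℝ) : ℂ) * u k

/-- The single mode `exp (i k_j · x)`. -/
def mode (Q : ℕ) (j : Fin Q) : FourierSeries Q := fun k =>
  if (k : ℂ) = waveVec Q j then 1 else 0

/-- The leading coefficient `U⁽⁰⁾ = ∑ j, exp (i k_j · x)`. -/
def leading (Q : ℕ) : FourierSeries Q := ∑ j, mode Q j

/-- Invariance under the rotation by `2 π / Q` of the plane. -/
def RotInvariant {Q : ℕ} (u : FourierSeries Q) : Prop :=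
  ∀ k k' : quasilattice Q,
    (k' : ℂ) = Complex.exp (2 * Real.pi * Complex.I / (Q : ℂ)) * (k : ℂ) → u k' = u k

/-- The function with Fourier coefficients `u` is real: `u_{-k}` is the conjugate of `u_k`. -/
def IsRealValued {Q : ℕ} (u : FourierSeries Q) : Prop :=
  ∀ k k' : quasilattice Q, (k' : ℂ) = -(k : ℂ) → u k' = conj (u k)

/-- Formal power series `∑ m, μ ^ (m / 2) V_m` in `μ ^ (1 / 2)`. -/
abbrev FormalSeries (Q : ℕ) : Type := ℕ → FourierSeries Q

/-- Cauchy product of two formal power series in `μ ^ (1 / 2)`. -/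
def FormalSeries.mul {Q : ℕ} (V W : FormalSeries Q) : FormalSeries Q := fun m =>
  ∑ p ∈ Finset.HasAntidiagonal.antidiagonal m, Quasipattern.mul (V p.1) (W p.2)

/-- Multiplication of a formal power series in `μ ^ (1 / 2)` by `μ`. -/
def FormalSeries.muMul {Q : ℕ} (V : FormalSeries Q) : FormalSeries Q
  | 0 => 0
  | 1 => 0
  | m + 2 => V m

/-- `V` solves `(1 + Δ) ^ 2 V - μ V + V ^ 3 = 0` at every order in `μ ^ (1 / 2)`. -/
def IsFormalSolution {Q : ℕ} (V : FormalSeries Q) : Prop :=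
  ∀ m : ℕ, L0 (V m) - FormalSeries.muMul V m
    + FormalSeries.mul (FormalSeries.mul V V) V m = 0

/-- The number `β = 3 (Q - 1)`. -/
def beta (Q : ℕ) : ℝ := 3 * ((Q : ℝ) - 1)

/-- The series `(μ / β) ^ (1 / 2) * ∑ n, μ ^ n U⁽ⁿ⁾`, as a series in `μ ^ (1 / 2)`. -/
def amplitudeSeries {Q : ℕ} (U : ℕ → FourierSeries Q) : FormalSeries Q := fun m =>
  if Odd m then (((Real.sqrt (beta Q))⁻¹ : ℝ) : ℂ) • U (m / 2) else 0

/-- The integer `l = φ(Q) / 2 - 1`. -/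
def ell (Q : ℕ) : ℕ := Nat.totient Q / 2 - 1

/-- A formal quasipattern solution in `H_s`: a formal power series in `μ ^ (1 / 2)` with
coefficients in `H_s` that are invariant under rotation by `2 π / Q`, which solves the steady
equation, vanishes at `μ = 0`, and whose term in `μ ^ (1 / 2)` is a positive multiple of
`∑ j, exp (i k_j · x)`. -/
structure IsQuasipatternSolution (Q : ℕ) (s : ℝ) (V : FormalSeries Q) : Prop where
  mem : ∀ m, MemH Q s (V m)
  rot : ∀ m, RotInvariant (V m)
  sol : IsFormalSolution V
  zero : V 0 = 0
  one : ∃ a : ℝ, 0 < a ∧ V 1 = (a : ℂ) • leading Q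

end

end Quasipattern

namespace Quasipattern

noncomputable section

/-! Write L = (1 + Δ)². The expansion solves L U⁽ⁿ⁺¹⁾ = U⁽ⁿ⁾ - β⁻¹ (U³)⁽ⁿ⁾. By Kronecker's theorem
the only points of Γ on the unit circle are the wavevectors (`exists_eq_waveVec_of_norm_eq_one`), so
on rotation-invariant series the kernel of L is spanned by U⁽⁰⁾ and each order carries one scalar
solvability condition. Counting the triples of wavevectors with sum k_1 gives β
(`coeff_leadingPoly_cube`), so in that condition the new amplitude has coefficient 1 - 3 = -2: it is
determined, which yields both existence (`opL_coeff_solU_succ`) and uniqueness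
(`IsPolySolution.unique`). Each order involves finitely many modes, even for an arbitrary solution
in H_s (`finite_support_of_isFormalSolution`), so the algebra takes place in power series over
trigonometric polynomials.

The estimates rest on a small divisor bound. The number 1 - |k|² is the image of a nonzero
cyclotomic integer, whose norm is at least 1 in absolute value. A conjugate pair of embeddings
contributes the symbol of L and the other φ(Q) - 2 embeddings contribute at most 1 + N² each
(`one_le_symbol_mul`). At order n + 1 the modes have N ≤ 2n + 3, so inverting L costs a constant
times (n + 1)^(4l), and these losses multiply up to (n!)^(4l).

Once this factor is removed, a majorant series closes the recursion (`exists_majorant`): the terms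
of the preceding order are absorbed by a large K, and the remaining ones are quadratic in a small δ.
This is done for the ℓ¹ norm of the coefficients; passing to H_s costs only a geometric factor, by
the bound on N. The algebra property of H_s (`exists_isAlgebraConst`) is independent of this, and
its constant affects only the final choice of δ. -/

lemma waveVec_eq_pow (Q : ℕ) (j : Fin Q) :
    waveVec Q j = Complex.exp (2 * Real.pi * Complex.I / (Q : ℂ)) ^ (j : ℕ) := by
  rw [waveVec, ← Complex.exp_nat_mul]
  congr 1
  ring

lemma norm_waveVec {Q : ℕ} (j : Fin Q) : ‖waveVec Q j‖ = 1 := by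
  have hQ : Q ≠ 0 := by rintro rfl; exact j.elim0
  rw [waveVec_eq_pow, norm_pow, (Complex.isPrimitiveRoot_exp Q hQ).norm'_eq_one hQ, one_pow]

lemma isIntegral_natCast (K : Type*) [Field K] (n : ℕ) : IsIntegral ℤ (n : K) := by
  simpa using isIntegral_algebraMap (A := K) (x := (n : ℤ))

/-! ### Cyclotomic integers: Kronecker's theorem and the Liouville bound -/

section Cyclotomic

open Finset

variable {Q : ℕ} [NeZero Q]

instance : IsCyclotomicExtension {Q} ℚ (CyclotomicField Q ℚ) :=
  CyclotomicField.isCyclotomicExtension Q ℚ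

/-- The cyclotomic integer with coordinates `m`. -/
def cycloInt (m : Fin Q → ℕ) : CyclotomicField Q ℚ :=
  ∑ j, (m j : CyclotomicField Q ℚ) * IsCyclotomicExtension.zeta Q ℚ (CyclotomicField Q ℚ) ^ (j : ℕ)

/-- The complex conjugate of the cyclotomic integer with coordinates `m`. -/
def cycloIntConj (m : Fin Q → ℕ) : CyclotomicField Q ℚ :=
  ∑ j, (m j : CyclotomicField Q ℚ) *
    (IsCyclotomicExtension.zeta Q ℚ (CyclotomicField Q ℚ))⁻¹ ^ (j : ℕ)

lemma zeta_primitive : IsPrimitiveRoot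
    (IsCyclotomicExtension.zeta Q ℚ (CyclotomicField Q ℚ)) Q :=
  IsCyclotomicExtension.zeta_spec Q ℚ (CyclotomicField Q ℚ)

lemma isIntegral_cycloInt (m : Fin Q → ℕ) : IsIntegral ℤ (cycloInt m) :=
  IsIntegral.sum _ fun j _ => (isIntegral_natCast _ (m j)).mul
    ((zeta_primitive.isIntegral (NeZero.pos Q)).pow _)

lemma isIntegral_cycloIntConj (m : Fin Q → ℕ) : IsIntegral ℤ (cycloIntConj m) :=
  IsIntegral.sum _ fun j _ => (isIntegral_natCast _ (m j)).mul
    ((zeta_primitive.inv.isIntegral (NeZero.pos Q)).pow _)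

/-- Every embedding sends ζ to the unit circle, where inversion is conjugation. Hence 1 - |σ x|²
comes from one element of the field for all σ at once. -/
lemma map_cycloIntConj (σ : CyclotomicField Q ℚ →ₐ[ℚ] ℂ) (m : Fin Q → ℕ) :
    σ (cycloIntConj m) = conj (σ (cycloInt m)) := by
  have h : ‖σ (IsCyclotomicExtension.zeta Q ℚ (CyclotomicField Q ℚ))‖ = 1 :=
    (zeta_primitive.map_of_injective σ.injective).norm'_eq_one (NeZero.ne Q)
  simp only [cycloInt, cycloIntConj, map_sum, map_mul, map_natCast, map_pow, map_inv₀,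
    Complex.inv_eq_conj h]

lemma norm_map_cycloInt_le (σ : CyclotomicField Q ℚ →ₐ[ℚ] ℂ) (m : Fin Q → ℕ) :
    ‖σ (cycloInt m)‖ ≤ ∑ j, m j := by
  have h : ‖σ (IsCyclotomicExtension.zeta Q ℚ (CyclotomicField Q ℚ))‖ = 1 :=
    (zeta_primitive.map_of_injective σ.injective).norm'_eq_one (NeZero.ne Q)
  rw [cycloInt, map_sum]
  refine (norm_sum_le _ _).trans (le_of_eq ?_)
  push_cast
  exact sum_congr rfl fun j _ => by simp [h]

lemma exists_embedding : ∃ σ : CyclotomicField Q ℚ →ₐ[ℚ] ℂ,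
    σ (IsCyclotomicExtension.zeta Q ℚ (CyclotomicField Q ℚ)) =
      Complex.exp (2 * Real.pi * Complex.I / (Q : ℂ)) := by
  have hirr := Polynomial.cyclotomic.irreducible_rat (NeZero.pos Q)
  let e := (zeta_primitive (Q := Q)).embeddingsEquivPrimitiveRoots ℂ hirr
  have hmem : Complex.exp (2 * Real.pi * Complex.I / (Q : ℂ)) ∈ primitiveRoots Q ℂ :=
    (mem_primitiveRoots (NeZero.pos Q)).2 (Complex.isPrimitiveRoot_exp Q (NeZero.ne Q))
  refine ⟨e.symm ⟨_, hmem⟩, ?_⟩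
  have := congrArg Subtype.val (e.apply_symm_apply ⟨_, hmem⟩)
  rwa [IsPrimitiveRoot.embeddingsEquivPrimitiveRoots_apply_coe] at this

lemma map_cycloInt_eq_combo {σ : CyclotomicField Q ℚ →ₐ[ℚ] ℂ}
    (hσ : σ (IsCyclotomicExtension.zeta Q ℚ (CyclotomicField Q ℚ)) =
      Complex.exp (2 * Real.pi * Complex.I / (Q : ℂ))) (m : Fin Q → ℕ) :
    σ (cycloInt m) = combo Q m := by
  simp only [cycloInt, combo, map_sum, map_mul, map_natCast, map_pow, hσ, waveVec_eq_pow]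

lemma map_one_sub_mul_conj (σ : CyclotomicField Q ℚ →ₐ[ℚ] ℂ) (m : Fin Q → ℕ) :
    σ (1 - cycloInt m * cycloIntConj m) = ((1 - ‖σ (cycloInt m)‖ ^ 2 : ℝ) : ℂ) := by
  rw [map_sub, map_mul, map_one, map_cycloIntConj, Complex.mul_conj, Complex.normSq_eq_norm_sq]
  push_cast; ring

/-- The points of norm one of the quasilattice are the wavevectors (Kronecker). -/
lemma exists_eq_waveVec_of_norm_eq_one (hQ : Even Q) (m : Fin Q → ℕ) (h : ‖combo Q m‖ = 1) :
    ∃ j, combo Q m = waveVec Q j := by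
  obtain ⟨σ, hσ⟩ := exists_embedding (Q := Q)
  -- The relation x x̄ = 1 holds in the field itself, so it transfers from one embedding to all of
  -- them, as Kronecker's theorem requires.
  have h0 : (1 - cycloInt m * cycloIntConj m) = 0 := by
    apply (map_eq_zero_iff σ σ.injective).1
    rw [map_one_sub_mul_conj, map_cycloInt_eq_combo hσ, h]
    simp
  have hall : ∀ τ : CyclotomicField Q ℚ →+* ℂ, ‖τ (cycloInt m)‖ = 1 := by
    intro τ
    have h1 := map_one_sub_mul_conj τ.toRatAlgHom m
    rw [h0, map_zero, eq_comm, Complex.ofReal_eq_zero] at h1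
    have h2 : ‖τ (cycloInt m)‖ ^ 2 = 1 := by
      have : ‖τ.toRatAlgHom (cycloInt m)‖ ^ 2 = 1 := by linarith
      exact this
    exact (pow_eq_one_iff_of_nonneg (norm_nonneg _) two_ne_zero).1 h2
  obtain ⟨n, hn, hpow⟩ := NumberField.Embeddings.pow_eq_one_of_norm_eq_one (CyclotomicField Q ℚ) ℂ
    (isIntegral_cycloInt m) hall
  have hprim := IsPrimitiveRoot.orderOf (cycloInt m)
  have hpos : 0 < orderOf (cycloInt m) := orderOf_pos_iff.2 (isOfFinOrder_iff_pow_eq_one.2 ⟨n, hn, hpow⟩)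
  have : NeZero (orderOf (cycloInt m)) := ⟨hpos.ne'⟩
  have hdvd := NumberField.Units.dvd_torsionOrder_of_isPrimitiveRoot hprim
  -- For even Q the roots of unity of the field are exactly the Q-th ones; for odd Q there would be
  -- 2Q of them.
  rw [IsCyclotomicExtension.Rat.torsionOrder_eq (n := Q), if_pos hQ] at hdvd
  have hQ1 : cycloInt m ^ Q = 1 := orderOf_dvd_iff_pow_eq_one.1 hdvd
  have hc : combo Q m ^ Q = 1 := by
    rw [← map_cycloInt_eq_combo hσ, ← map_pow, hQ1, map_one]
  obtain ⟨i, hi, hi'⟩ := (Complex.isPrimitiveRoot_exp Q (NeZero.ne Q)).eq_pow_of_pow_eq_one hc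
  exact ⟨⟨i, hi⟩, by rw [waveVec_eq_pow, ← hi']⟩

/-- Away from the unit circle, the symbol `(1 - |k| ^ 2) ^ 2` is bounded below by a power of the
order (Liouville). -/
lemma one_le_symbol_mul (hQ : 2 < Q) (m : Fin Q → ℕ) (h : ‖combo Q m‖ ≠ 1) :
    1 ≤ (1 - ‖combo Q m‖ ^ 2) ^ 2 * (1 + ((∑ j, m j : ℕ) : ℝ) ^ 2) ^ (Q.totient - 2) := by
  obtain ⟨σ, hσ⟩ := exists_embedding (Q := Q)
  set γ := 1 - cycloInt m * cycloIntConj m with hγ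
  have hσγ : σ γ = ((1 - ‖combo Q m‖ ^ 2 : ℝ) : ℂ) := by
    rw [hγ, map_one_sub_mul_conj, map_cycloInt_eq_combo hσ]
  have hγ0 : γ ≠ 0 := by
    rintro h0
    rw [h0, map_zero, eq_comm, Complex.ofReal_eq_zero] at hσγ
    exact h ((pow_eq_one_iff_of_nonneg (norm_nonneg _) two_ne_zero).1 (by linarith))
  have hint : IsIntegral ℤ γ :=
    isIntegral_one.sub ((isIntegral_cycloInt m).mul (isIntegral_cycloIntConj m))
  -- The norm of a nonzero algebraic integer is a nonzero rational integer.
  have hnorm : 1 ≤ ∏ τ : CyclotomicField Q ℚ →ₐ[ℚ] ℂ, ‖τ γ‖ := by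
    have h1 := Algebra.norm_eq_prod_embeddings ℚ ℂ γ
    obtain ⟨a, ha⟩ := IsIntegrallyClosed.isIntegral_iff.1 (Algebra.isIntegral_norm ℚ hint)
    have ha0 : a ≠ 0 := by
      rintro rfl
      rw [map_zero, eq_comm, Algebra.norm_eq_zero_iff] at ha
      exact hγ0 ha
    rw [← norm_prod, ← h1, ← ha]
    simp only [algebraMap_int_eq, eq_intCast, map_intCast, Complex.norm_intCast]
    exact_mod_cast Int.one_le_abs ha0
  let τ₀ : CyclotomicField Q ℚ →ₐ[ℚ] ℂ :=
    (((starRingEnd ℂ).comp (σ : CyclotomicField Q ℚ →+* ℂ))).toRatAlgHom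
  have hτ : ∀ x, τ₀ x = conj (σ x) := fun _ => rfl
  -- If σ were its own conjugate, exp(2πi/Q) would be real with square 1, contradicting Q > 2.
  have hne : σ ≠ τ₀ := by
    intro he
    have h1 := hτ (IsCyclotomicExtension.zeta Q ℚ (CyclotomicField Q ℚ))
    rw [← he, hσ] at h1
    have hp := Complex.isPrimitiveRoot_exp Q (NeZero.ne Q)
    set w := Complex.exp (2 * Real.pi * Complex.I / (Q : ℂ))
    have hw : ‖w‖ = 1 := hp.norm'_eq_one (NeZero.ne Q)
    have h2 : w ^ 2 = 1 := by
      rw [sq]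
      nth_rewrite 2 [h1]
      rw [Complex.mul_conj, Complex.normSq_eq_norm_sq, hw]; simp
    have := Nat.le_of_dvd (by norm_num) (hp.dvd_of_pow_eq_one 2 h2)
    omega
  have hcard : Fintype.card (CyclotomicField Q ℚ →ₐ[ℚ] ℂ) = Q.totient := by
    rw [AlgHom.card, IsCyclotomicExtension.finrank (n := Q) _
      (Polynomial.cyclotomic.irreducible_rat (NeZero.pos Q))]
  classical
  -- The pair σ, τ₀ produces the squared factor; each of the other factors is at most 1 + N².
  rw [← prod_sdiff (subset_univ ({σ, τ₀} : Finset _)), prod_pair hne, mul_comm] at hnorm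
  refine hnorm.trans ?_
  have e1 : ‖σ γ‖ * ‖τ₀ γ‖ = (1 - ‖combo Q m‖ ^ 2) ^ 2 := by
    rw [hτ, RCLike.norm_conj, hσγ, Complex.norm_real, Real.norm_eq_abs, ← sq, sq_abs]
  rw [e1]
  refine mul_le_mul_of_nonneg_left ?_ (sq_nonneg _)
  have e2 : #(univ \ ({σ, τ₀} : Finset (CyclotomicField Q ℚ →ₐ[ℚ] ℂ))) = Q.totient - 2 := by
    rw [card_sdiff_of_subset (subset_univ _), card_univ, hcard, card_pair hne]
  rw [← e2]
  rw [← prod_const]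
  refine prod_le_prod (fun _ _ => norm_nonneg _) fun τ _ => ?_
  rw [map_one_sub_mul_conj, Complex.norm_real, Real.norm_eq_abs, abs_le]
  have hle := norm_map_cycloInt_le τ m
  have := norm_nonneg (τ (cycloInt m))
  have := pow_le_pow_left₀ this hle 2
  constructor <;> nlinarith [sq_nonneg ‖τ (cycloInt m)‖]

end Cyclotomic

/-! ### The order function -/

section Order

variable {Q : ℕ}

lemma combo_add (m n : Fin Q → ℕ) : combo Q (m + n) = combo Q m + combo Q n := by
  simp [combo, add_mul, Finset.sum_add_distrib]

lemma combo_single (j : Fin Q) : combo Q (Pi.single j 1) = waveVec Q j := by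
  simp [combo, Pi.single_apply]

lemma exists_combo_order (k : quasilattice Q) :
    ∃ m : Fin Q → ℕ, (k : ℂ) = combo Q m ∧ order Q k = ∑ j, m j := by
  obtain ⟨m, hm⟩ := k.2
  exact Nat.sInf_mem (s := {n | ∃ m : Fin Q → ℕ, (k : ℂ) = combo Q m ∧ n = ∑ j, m j})
    ⟨_, m, hm, rfl⟩

lemma order_le {k : quasilattice Q} {m : Fin Q → ℕ} (h : (k : ℂ) = combo Q m) :
    order Q k ≤ ∑ j, m j :=
  Nat.sInf_le ⟨m, h, rfl⟩

lemma order_add_le (p q : quasilattice Q) : order Q (p + q) ≤ order Q p + order Q q := by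
  obtain ⟨m, hm, hm'⟩ := exists_combo_order p
  obtain ⟨n, hn, hn'⟩ := exists_combo_order q
  rw [hm', hn', ← Finset.sum_add_distrib]
  exact order_le (m := m + n) (by rw [combo_add, ← hm, ← hn]; rfl)

/-- The `j`-th wavevector, as a point of the quasilattice. -/
def wave (j : Fin Q) : quasilattice Q := ⟨waveVec Q j, Pi.single j 1, (combo_single j).symm⟩

@[simp] lemma coe_wave (j : Fin Q) : (wave j : ℂ) = waveVec Q j := rfl

lemma order_wave_le (j : Fin Q) : order Q (wave j) ≤ 1 :=
  (order_le (m := Pi.single j 1) (combo_single j).symm).trans (by simp [Pi.single_apply])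

end Order

/-! ### Growth and summability of the weights -/

section Weight

variable {Q : ℕ} {s : ℝ}

lemma weight_pos (k : quasilattice Q) : 0 < weight Q s k :=
  Real.rpow_pos_of_pos (by positivity) _

/-- The order of a sum is at most twice the larger order b, and 1 + (2b)² ≤ 4 (1 + b²). -/
lemma weight_add_le (hs : 0 ≤ s) (p q : quasilattice Q) :
    weight Q s (p + q) ≤ 4 ^ s * (weight Q s p + weight Q s q) := by
  have key : ∀ a b c : ℝ, 0 ≤ a → 0 ≤ b → a ≤ c + b → c ≤ b →
      (1 + a ^ 2) ^ s ≤ 4 ^ s * (1 + b ^ 2) ^ s := by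
    intro a b c ha hb hab hcb
    rw [← Real.mul_rpow (by norm_num) (by positivity)]
    exact Real.rpow_le_rpow (by positivity) (by nlinarith) hs
  have hadd : (order Q (p + q) : ℝ) ≤ order Q p + order Q q := mod_cast order_add_le p q
  have hp := (weight_pos (s := s) p).le
  have hq := (weight_pos (s := s) q).le
  have h4 : (0 : ℝ) ≤ 4 ^ s := by positivity
  rcases le_total (order Q p : ℝ) (order Q q) with h | h
  · refine (key _ _ _ (by positivity) (by positivity) hadd h).trans ?_
    exact mul_le_mul_of_nonneg_left (le_add_of_nonneg_left hp) h4
  · refine (key _ _ _ (by positivity) (by positivity) (hadd.trans (add_comm _ _).le) h).trans ?_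
    exact mul_le_mul_of_nonneg_left (le_add_of_nonneg_right hq) h4

lemma waveVec_natAdd {h : ℕ} (j : Fin h) :
    waveVec (h + h) (Fin.natAdd h j) = -waveVec (h + h) (Fin.castAdd h j) := by
  have hh : (h : ℂ) ≠ 0 := by
    have := j.pos
    exact_mod_cast this.ne'
  have h1 : Complex.exp (2 * Real.pi * Complex.I / ((h + h : ℕ) : ℂ)) ^ h = -1 := by
    rw [← Complex.exp_nat_mul, ← Complex.exp_pi_mul_I]
    congr 1
    push_cast
    field_simp
    ring
  rw [waveVec_eq_pow, waveVec_eq_pow, Fin.val_natAdd, pow_add, h1, Fin.val_castAdd]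
  ring

/-- Opposite wavevectors cancel in pairs, so a minimal representation of k yields coordinates in
ℤ^(Q/2) that determine k and have sup norm at most its order. The sum of ‖x‖^(-2s) over this lattice
converges because 2s > Q/2. -/
lemma summable_inv_weight (hQ : Even Q) (hs : (Q : ℝ) / 4 < s) :
    Summable fun k : quasilattice Q => (weight Q s k)⁻¹ := by
  obtain ⟨h, rfl⟩ := hQ
  have hs0 : 0 < s := lt_of_le_of_lt (by positivity) hs
  choose m hm hm' using exists_combo_order (Q := h + h)
  let L := Submodule.span ℤ (Set.range (Pi.basisFun ℝ (Fin h)))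
  let f : quasilattice (h + h) → Fin h → ℤ := fun k j =>
    (m k (Fin.castAdd h j) : ℤ) - m k (Fin.natAdd h j)
  have hf : ∀ k : quasilattice (h + h),
      (k : ℂ) = ∑ j, (f k j : ℂ) * waveVec (h + h) (Fin.castAdd h j) := by
    intro k
    rw [hm k, combo, Fin.sum_univ_add, ← Finset.sum_add_distrib]
    refine Finset.sum_congr rfl fun j _ => ?_
    rw [waveVec_natAdd]
    push_cast [f]
    ring
  let F : quasilattice (h + h) → L := fun k => ⟨fun j => (f k j : ℝ), by
    rw [Module.Basis.mem_span_iff_repr_mem]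
    intro j
    exact ⟨f k j, by simp⟩⟩
  have hF : Function.Injective F := by
    intro k k' hkk
    apply Subtype.ext
    rw [hf k, hf k']
    refine Finset.sum_congr rfl fun j _ => ?_
    have : (f k j : ℝ) = f k' j := congrFun (congrArg Subtype.val hkk) j
    rw [Int.cast_injective this]
  have hrank : Module.finrank ℤ L = h := by
    rw [ZLattice.rank ℝ]; simp
  have hsum := (ZLattice.summable_norm_rpow L (-(2 * s)) (by
    rw [hrank]; push_cast at hs; linarith)).comp_injective hF
  -- The origin needs its own term: the comparison series does not control the weight there, since 0
  -- to a nonzero real power is 0.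
  have hsum2 : Summable fun k : quasilattice (h + h) => if k = 0 then (1 : ℝ) else 0 :=
    summable_of_hasFiniteSupport ((Set.finite_singleton 0).subset fun k => by simp +contextual)
  refine Summable.of_nonneg_of_le (fun k => (inv_pos.2 (weight_pos k)).le) (fun k => ?_)
    (hsum.add hsum2)
  have hnorm : ‖F k‖ ≤ order (h + h) k := by
    change ‖(fun j => (f k j : ℝ))‖ ≤ _
    rw [pi_norm_le_iff_of_nonneg (by positivity)]
    intro j
    rw [hm' k, Fin.sum_univ_add]
    have h1 := Finset.single_le_sum (f := fun i => m k (Fin.castAdd h i))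
      (fun _ _ => Nat.zero_le _) (Finset.mem_univ j)
    have h2 := Finset.single_le_sum (f := fun i => m k (Fin.natAdd h i))
      (fun _ _ => Nat.zero_le _) (Finset.mem_univ j)
    have h3 : |f k j| ≤ ((∑ i, m k (Fin.castAdd h i) + ∑ i, m k (Fin.natAdd h i) : ℕ) : ℤ) := by
      simp only [f] at *
      rw [abs_le]
      omega
    rw [Real.norm_eq_abs]
    exact_mod_cast h3
  by_cases hk : F k = 0
  · have hk0 : k = 0 := by
      apply Subtype.ext
      rw [hf k]
      simp only [ZeroMemClass.coe_zero]
      refine Finset.sum_eq_zero fun j _ => ?_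
      have : (f k j : ℝ) = 0 := congrFun (congrArg Subtype.val hk) j
      rw [Int.cast_eq_zero.1 this]; simp
    have h1 : (weight (h + h) s k)⁻¹ ≤ 1 :=
      inv_le_one_of_one_le₀ (Real.one_le_rpow (by simp) hs0.le)
    simp only [Function.comp, hk0, if_true] at *
    have : 0 ≤ ‖F 0‖ ^ (-(2 * s)) := by positivity
    linarith
  · have hpos : 0 < ‖F k‖ := norm_pos_iff.2 hk
    have h1 : (weight (h + h) s k)⁻¹ ≤ ‖F k‖ ^ (-(2 * s)) := by
      rw [Real.rpow_neg hpos.le, Real.rpow_mul hpos.le, weight]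
      refine inv_anti₀ (by positivity) (Real.rpow_le_rpow (by positivity) ?_ hs0.le)
      rw [Real.rpow_two]
      nlinarith
    have : (0 : ℝ) ≤ if k = 0 then (1 : ℝ) else 0 := by split_ifs <;> norm_num
    simp only [Function.comp]
    linarith

end Weight

/-! ### The algebra property of H_s -/

section Algebra

/-- Weighted Cauchy–Schwarz inequality for series. -/
lemma sq_tsum_le_tsum_inv_mul_tsum {ι : Type*} {a f : ι → ℝ} (ha : ∀ i, 0 < a i)
    (hf : ∀ i, 0 ≤ f i) (h1 : Summable fun i => (a i)⁻¹) (h2 : Summable fun i => a i * f i ^ 2) :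
    Summable f ∧ (∑' i, f i) ^ 2 ≤ (∑' i, (a i)⁻¹) * ∑' i, a i * f i ^ 2 := by
  have e1 : ∀ i, (Real.sqrt (a i))⁻¹ ^ (2 : ℝ) = (a i)⁻¹ := fun i => by
    rw [Real.rpow_two, inv_pow, Real.sq_sqrt (ha i).le]
  have e2 : ∀ i, (Real.sqrt (a i) * f i) ^ (2 : ℝ) = a i * f i ^ 2 := fun i => by
    rw [Real.rpow_two, mul_pow, Real.sq_sqrt (ha i).le]
  have e3 : ∀ i, (Real.sqrt (a i))⁻¹ * (Real.sqrt (a i) * f i) = f i := fun i => by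
    rw [inv_mul_cancel_left₀ (Real.sqrt_pos.2 (ha i)).ne']
  have key := Real.summable_and_inner_le_Lp_mul_Lq_tsum_of_nonneg
    (f := fun i => (Real.sqrt (a i))⁻¹) (g := fun i => Real.sqrt (a i) * f i)
    Real.HolderConjugate.two_two (fun i => by positivity)
    (fun i => mul_nonneg (by positivity) (hf i)) (by simpa only [e1] using h1)
    (by simpa only [e2] using h2)
  simp only [e1, e2, e3] at key
  refine ⟨key.1, ?_⟩
  have hA : 0 ≤ ∑' i, (a i)⁻¹ := tsum_nonneg fun i => (inv_pos.2 (ha i)).le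
  have hB : 0 ≤ ∑' i, a i * f i ^ 2 := tsum_nonneg fun i => mul_nonneg (ha i).le (sq_nonneg _)
  have := pow_le_pow_left₀ (tsum_nonneg hf) key.2 2
  rwa [← Real.sqrt_eq_rpow, ← Real.sqrt_eq_rpow, mul_pow, Real.sq_sqrt hA, Real.sq_sqrt hB] at this

variable {Q : ℕ} {s : ℝ}

/-- Dividing `weight_add_le` by the product of the weights bounds each term by 4^s (1/w_p + 1/w_q).
Either component determines the pair on a fibre, so both sums are at most the total one. The bound
is uniform in k, which is what Cauchy–Schwarz on the convolution needs. -/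
lemma weight_mul_tsum_inv_le (hs : 0 ≤ s) (hS : Summable fun k : quasilattice Q => (weight Q s k)⁻¹)
    (k : quasilattice Q) :
    (Summable fun p : {p : quasilattice Q × quasilattice Q // p.1 + p.2 = k} =>
        (weight Q s p.1.1 * weight Q s p.1.2)⁻¹) ∧
      weight Q s k * ∑' p : {p : quasilattice Q × quasilattice Q // p.1 + p.2 = k},
        (weight Q s p.1.1 * weight Q s p.1.2)⁻¹ ≤
      2 * 4 ^ s * ∑' k : quasilattice Q, (weight Q s k)⁻¹ := by
  have i1 : Function.Injective
      fun p : {p : quasilattice Q × quasilattice Q // p.1 + p.2 = k} => p.1.1 := by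
    rintro ⟨⟨a, b⟩, h⟩ ⟨⟨a', b'⟩, h'⟩ (rfl : a = a')
    have : b = b' := add_left_cancel (h.trans h'.symm)
    subst this; rfl
  have i2 : Function.Injective
      fun p : {p : quasilattice Q × quasilattice Q // p.1 + p.2 = k} => p.1.2 := by
    rintro ⟨⟨a, b⟩, h⟩ ⟨⟨a', b'⟩, h'⟩ (rfl : b = b')
    have : a = a' := add_right_cancel (h.trans h'.symm)
    subst this; rfl
  have hw : ∀ k : quasilattice Q, 0 ≤ (weight Q s k)⁻¹ := fun k => (inv_pos.2 (weight_pos k)).le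
  have s1 := hS.comp_injective i1
  have s2 := hS.comp_injective i2
  have t1 := tsum_comp_le_tsum_of_inj hS hw i1
  have t2 := tsum_comp_le_tsum_of_inj hS hw i2
  have hle : ∀ p : {p : quasilattice Q × quasilattice Q // p.1 + p.2 = k},
      weight Q s k * (weight Q s p.1.1 * weight Q s p.1.2)⁻¹ ≤
        4 ^ s * ((weight Q s p.1.1)⁻¹ + (weight Q s p.1.2)⁻¹) := by
    rintro ⟨⟨a, b⟩, rfl⟩
    have ha := weight_pos (s := s) a
    have hb := weight_pos (s := s) b
    rw [← div_eq_mul_inv, div_le_iff₀ (mul_pos ha hb)]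
    refine (weight_add_le hs a b).trans (le_of_eq ?_)
    simp only
    field_simp
    ring
  have hk := weight_pos (s := s) k
  have hsum : Summable fun p : {p : quasilattice Q × quasilattice Q // p.1 + p.2 = k} =>
      weight Q s k * (weight Q s p.1.1 * weight Q s p.1.2)⁻¹ :=
    Summable.of_nonneg_of_le
      (fun p => mul_nonneg hk.le (inv_nonneg.2 (mul_pos (weight_pos _) (weight_pos _)).le)) hle
      ((s1.add s2).mul_left _)
  refine ⟨(summable_mul_left_iff hk.ne').1 hsum, ?_⟩
  rw [← tsum_mul_left]
  refine (hsum.tsum_le_tsum hle ((s1.add s2).mul_left _)).trans ?_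
  have hadd := s1.tsum_add s2
  simp only [Function.comp_apply] at hadd
  rw [tsum_mul_left, hadd]
  have h4 : (0 : ℝ) ≤ 4 ^ s := by positivity
  have := mul_le_mul_of_nonneg_left (add_le_add t1 t2) h4
  refine this.trans (le_of_eq (by ring))

lemma exists_isAlgebraConst (hQ : Even Q) (hs : (Q : ℝ) / 4 < s) : ∃ c, IsAlgebraConst Q s c := by
  have hs0 : 0 ≤ s := (lt_of_le_of_lt (by positivity) hs).le
  have hS := summable_inv_weight hQ hs
  set C := 2 * 4 ^ s * ∑' k : quasilattice Q, (weight Q s k)⁻¹ with hC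
  have hC0 : 0 ≤ C := mul_nonneg (by positivity)
    (tsum_nonneg fun k => (inv_pos.2 (weight_pos k)).le)
  -- The summand 1 makes the constant visibly positive.
  refine ⟨Real.sqrt C + 1, by positivity, fun u v hu hv => ?_⟩
  let G : quasilattice Q × quasilattice Q → ℝ := fun p =>
    (weight Q s p.1 * ‖u p.1‖ ^ 2) * (weight Q s p.2 * ‖v p.2‖ ^ 2)
  have n0 : ∀ (w : FourierSeries Q) k, 0 ≤ weight Q s k * ‖w k‖ ^ 2 := fun w k =>
    mul_nonneg (weight_pos k).le (sq_nonneg _)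
  have hG : Summable G := Summable.mul_of_nonneg hu hv (n0 u) (n0 v)
  let e := Equiv.sigmaFiberEquiv fun p : quasilattice Q × quasilattice Q => p.1 + p.2
  have hGe : Summable (G ∘ e) := (e.summable_iff).2 hG
  have hfib : Summable fun k => ∑' p : {p : quasilattice Q × quasilattice Q // p.1 + p.2 = k},
      G p.1 := hGe.sigma
  have htot : ∑' k, ∑' p : {p : quasilattice Q × quasilattice Q // p.1 + p.2 = k}, G p.1 =
      (∑' k, weight Q s k * ‖u k‖ ^ 2) * ∑' k, weight Q s k * ‖v k‖ ^ 2 := by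
    have h1 := hGe.tsum_sigma
    have h2 := e.tsum_eq G
    have h3 := Summable.tsum_mul_tsum hu hv hG
    rw [h3]
    exact h1.symm.trans h2
  have hpt : ∀ k, weight Q s k * ‖mul u v k‖ ^ 2 ≤
      C * ∑' p : {p : quasilattice Q × quasilattice Q // p.1 + p.2 = k}, G p.1 := by
    intro k
    obtain ⟨hs1, hle⟩ := weight_mul_tsum_inv_le hs0 hS k
    have hGk : ∀ p : {p : quasilattice Q × quasilattice Q // p.1 + p.2 = k},
        (weight Q s p.1.1 * weight Q s p.1.2) * (‖u p.1.1‖ * ‖v p.1.2‖) ^ 2 = G p.1 := by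
      intro p
      simp only [G]; ring
    have hGs : Summable fun p : {p : quasilattice Q × quasilattice Q // p.1 + p.2 = k} => G p.1 :=
      hGe.sigma_factor k
    obtain ⟨hfs, hcs⟩ := sq_tsum_le_tsum_inv_mul_tsum
      (a := fun p : {p : quasilattice Q × quasilattice Q // p.1 + p.2 = k} =>
        weight Q s p.1.1 * weight Q s p.1.2) (f := fun p => ‖u p.1.1‖ * ‖v p.1.2‖)
      (fun p => mul_pos (weight_pos _) (weight_pos _)) (fun p => by positivity) hs1
      (by simpa only [hGk] using hGs)
    simp only [hGk] at hcs
    have hn : ‖mul u v k‖ ≤ ∑' p : {p : quasilattice Q × quasilattice Q // p.1 + p.2 = k},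
        ‖u p.1.1‖ * ‖v p.1.2‖ := by
      refine (norm_tsum_le_tsum_norm (by simpa only [norm_mul] using hfs)).trans (le_of_eq ?_)
      simp only [norm_mul]
    have hn2 := (pow_le_pow_left₀ (norm_nonneg _) hn 2).trans hcs
    refine (mul_le_mul_of_nonneg_left hn2 (weight_pos k).le).trans ?_
    rw [← mul_assoc]
    exact mul_le_mul_of_nonneg_right hle
      (tsum_nonneg fun p => mul_nonneg (n0 u _) (n0 v _))
  have hmem : MemH Q s (mul u v) :=
    Summable.of_nonneg_of_le (n0 _) hpt (hfib.mul_left C)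
  refine ⟨hmem, ?_⟩
  have hle := hmem.tsum_le_tsum hpt (hfib.mul_left C)
  rw [tsum_mul_left, htot] at hle
  have hnn : ∀ w : FourierSeries Q, 0 ≤ ∑' k, weight Q s k * ‖w k‖ ^ 2 := fun w => tsum_nonneg (n0 w)
  calc hNorm Q s (mul u v) ≤ Real.sqrt (C * ((∑' k, weight Q s k * ‖u k‖ ^ 2) *
        ∑' k, weight Q s k * ‖v k‖ ^ 2)) := Real.sqrt_le_sqrt hle
    _ = Real.sqrt C * (hNorm Q s u * hNorm Q s v) := by
        rw [Real.sqrt_mul hC0, Real.sqrt_mul (hnn u)]; rfl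
    _ ≤ (Real.sqrt C + 1) * hNorm Q s u * hNorm Q s v := by
        rw [mul_assoc]
        exact mul_le_mul_of_nonneg_right (by linarith)
          (mul_nonneg (Real.sqrt_nonneg _) (Real.sqrt_nonneg _))

end Algebra

/-- Trigonometric polynomials over the quasilattice. -/
abbrev TrigPoly (Q : ℕ) : Type := AddMonoidAlgebra ℂ (quasilattice Q)

/-! ### Trigonometric polynomials and diagonal operators -/

section FourierSeries

variable {Q : ℕ} {s : ℝ}

/-- The Fourier series of a trigonometric polynomial. -/
def toFourier : TrigPoly Q →ₗ[ℂ] FourierSeries Q where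
  toFun a := ⇑a.coeff
  map_add' _ _ := rfl
  map_smul' _ _ := rfl

lemma toFourier_apply (a : TrigPoly Q) (k : quasilattice Q) : toFourier a k = a.coeff k := rfl

lemma toFourier_injective : Function.Injective (toFourier (Q := Q)) := fun _ _ h =>
  AddMonoidAlgebra.coeff_injective (DFunLike.coe_injective h)

lemma exists_toFourier_eq {u : FourierSeries Q} (hu : (Function.support u).Finite) :
    ∃ a : TrigPoly Q, toFourier a = u :=
  ⟨.ofCoeff (Finsupp.ofSupportFinite u hu), rfl⟩

lemma mul_toFourier (a b : TrigPoly Q) :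
    mul (toFourier a) (toFourier b) = toFourier (a * b) := by
  classical
  funext k
  rw [mul, toFourier_apply, AddMonoidAlgebra.coeff_mul, Finsupp.sum]
  simp only [Finsupp.sum]
  rw [← Finset.sum_product']
  refine (tsum_subtype {p : quasilattice Q × quasilattice Q | p.1 + p.2 = k}
    (fun p => toFourier a p.1 * toFourier b p.2)).trans ?_
  rw [tsum_eq_sum (s := a.coeff.support ×ˢ b.coeff.support)]
  · refine Finset.sum_congr rfl fun p _ => ?_
    simp only [Set.indicator_apply, Set.mem_ofPred_eq, toFourier_apply]
  · intro p hp
    rw [Finset.mem_product, not_and_or, Finsupp.notMem_support_iff,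
      Finsupp.notMem_support_iff] at hp
    simp only [Set.indicator_apply, toFourier_apply]
    rcases hp with h | h <;> simp [h]

lemma memH_toFourier (a : TrigPoly Q) : MemH Q s (toFourier a) :=
  summable_of_hasFiniteSupport (a.coeff.hasFiniteSupport.subset fun k hk hk' => hk (by
    simp [toFourier_apply, hk']))

lemma mode_apply (j : Fin Q) (k : quasilattice Q) [Decidable (wave j = k)] :
    mode Q j k = if wave j = k then 1 else 0 := by
  rw [mode]
  refine if_congr ?_ rfl rfl
  rw [Subtype.ext_iff, coe_wave, eq_comm]

/-- The trigonometric polynomial `∑ j, exp (i k_j · x)`. -/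
def leadingPoly (Q : ℕ) : TrigPoly Q := ∑ j : Fin Q, AddMonoidAlgebra.single (wave j) 1

lemma toFourier_leadingPoly : toFourier (leadingPoly Q) = leading Q := by
  classical
  rw [leadingPoly, map_sum, leading]
  refine Finset.sum_congr rfl fun j _ => funext fun k => ?_
  rw [toFourier_apply, AddMonoidAlgebra.coeff_single, Finsupp.single_apply, mode_apply]

lemma hInner_mode_eq_zero {u : FourierSeries Q} {j : Fin Q} (h : u (wave j) = 0) :
    hInner Q s u (mode Q j) = 0 := by
  classical
  refine (tsum_congr fun k => ?_).trans tsum_zero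
  rw [mode_apply]
  split_ifs with hk
  · subst hk; simp [h]
  · simp

/-- The diagonal operator with symbol `f`. -/
def diagOp (f : quasilattice Q → ℂ) : TrigPoly Q →ₗ[ℂ] TrigPoly Q where
  toFun a := .ofCoeff (Finsupp.onFinset a.coeff.support (fun k => f k * a.coeff k)
    fun k hk => Finsupp.mem_support_iff.2 (right_ne_zero_of_mul hk))
  map_add' a b := by ext k; simp [mul_add]
  map_smul' c a := by ext k; simp [mul_left_comm]

@[simp] lemma coeff_diagOp (f : quasilattice Q → ℂ) (a : TrigPoly Q) (k : quasilattice Q) :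
    (diagOp f a).coeff k = f k * a.coeff k := rfl

/-- The symbol `(1 - |k| ^ 2) ^ 2`. -/
def symbol (k : quasilattice Q) : ℝ := (1 - ‖(k : ℂ)‖ ^ 2) ^ 2

/-- The operator `(1 + Δ) ^ 2` on trigonometric polynomials. -/
def opL : TrigPoly Q →ₗ[ℂ] TrigPoly Q := diagOp fun k => (symbol k : ℂ)

/-- The pseudo-inverse of `(1 + Δ) ^ 2`, vanishing on the kernel. -/
def opLInv : TrigPoly Q →ₗ[ℂ] TrigPoly Q := diagOp fun k => ((symbol k)⁻¹ : ℂ)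

lemma L0_toFourier (a : TrigPoly Q) : L0 (toFourier a) = toFourier (opL a) := rfl

lemma coeff_opL (a : TrigPoly Q) (k : quasilattice Q) :
    (opL a).coeff k = symbol k * a.coeff k := rfl

lemma coeff_opLInv (a : TrigPoly Q) (k : quasilattice Q) :
    (opLInv a).coeff k = (symbol k : ℂ)⁻¹ * a.coeff k := rfl

lemma symbol_wave (j : Fin Q) : symbol (wave j) = 0 := by simp [symbol, norm_waveVec]

lemma exists_eq_wave_of_symbol_eq_zero [NeZero Q] (hQ : Even Q) {k : quasilattice Q}
    (hk : symbol k = 0) : ∃ j, k = wave j := by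
  obtain ⟨m, hm⟩ := k.2
  have h1 : ‖(k : ℂ)‖ = 1 := by
    rw [symbol, sq_eq_zero_iff] at hk
    exact (pow_eq_one_iff_of_nonneg (norm_nonneg _) two_ne_zero).1 (by linarith)
  obtain ⟨j, hj⟩ := exists_eq_waveVec_of_norm_eq_one hQ m (by rw [← hm, h1])
  exact ⟨j, Subtype.ext (hm.trans hj)⟩

lemma inv_symbol_le (hQ : 2 < Q) {k : quasilattice Q} {d : ℕ} (hk : order Q k ≤ d) :
    (symbol k)⁻¹ ≤ (1 + (d : ℝ) ^ 2) ^ (Q.totient - 2) := by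
  have : NeZero Q := ⟨by omega⟩
  by_cases h0 : symbol k = 0
  -- On the kernel the inverse is 0 by convention, and the bound is trivial.
  · rw [h0, inv_zero]; positivity
  obtain ⟨m, hm, hm'⟩ := exists_combo_order k
  have h1 := one_le_symbol_mul hQ m (fun h => h0 (by rw [symbol, hm, h]; norm_num))
  rw [← hm, ← hm'] at h1
  have hpos : 0 < symbol k := lt_of_le_of_ne (sq_nonneg _) (Ne.symm h0)
  rw [inv_le_iff_one_le_mul₀ hpos, mul_comm]
  refine h1.trans (mul_le_mul_of_nonneg_left ?_ hpos.le)
  have : (order Q k : ℝ) ≤ d := mod_cast hk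
  gcongr

end FourierSeries

/-! ### Rotation invariance and solvability -/

section Rotation

variable {Q : ℕ}

lemma exp_pow_eq_one [NeZero Q] : Complex.exp (2 * Real.pi * Complex.I / (Q : ℂ)) ^ Q = 1 :=
  (Complex.isPrimitiveRoot_exp Q (NeZero.ne Q)).pow_eq_one

lemma waveVec_add_one [NeZero Q] (j : Fin Q) :
    waveVec Q (j + 1) = Complex.exp (2 * Real.pi * Complex.I / (Q : ℂ)) * waveVec Q j := by
  rw [waveVec_eq_pow, waveVec_eq_pow, ← pow_succ', Fin.val_add,
    ← pow_eq_pow_mod _ exp_pow_eq_one, pow_add]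
  rcases Nat.lt_or_ge 1 Q with h | h
  · rw [Fin.val_one', Nat.mod_eq_of_lt h, pow_one, pow_succ]
  · have h1 : Q = 1 := le_antisymm h (NeZero.pos Q)
    rw [Fin.val_one', pow_succ, ← pow_eq_pow_mod _ exp_pow_eq_one, pow_one]

lemma rot_mem [NeZero Q] (k : quasilattice Q) :
    Complex.exp (2 * Real.pi * Complex.I / (Q : ℂ)) * k ∈ quasilattice Q := by
  obtain ⟨m, hm⟩ := k.2
  refine ⟨fun j => m (j - 1), ?_⟩
  rw [hm, combo, combo, Finset.mul_sum, 
    ← Equiv.sum_comp (Equiv.addRight (1 : Fin Q)) fun j => ((m (j - 1) : ℕ) : ℂ) * waveVec Q j]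
  refine Finset.sum_congr rfl fun j _ => ?_
  simp only [Equiv.coe_addRight, add_sub_cancel_right, waveVec_add_one]
  ring

/-- The rotation by `2 π / Q` on the quasilattice. -/
def rot (Q : ℕ) [NeZero Q] : quasilattice Q →+ quasilattice Q where
  toFun k := ⟨_, rot_mem k⟩
  map_zero' := Subtype.ext (by simp)
  map_add' _ _ := Subtype.ext (by simp [mul_add])

lemma coe_rot [NeZero Q] (k : quasilattice Q) :
    (rot Q k : ℂ) = Complex.exp (2 * Real.pi * Complex.I / (Q : ℂ)) * k := rfl

lemma rot_injective [NeZero Q] : Function.Injective (rot Q) := fun _ _ h =>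
  Subtype.ext (mul_left_cancel₀ (Complex.exp_ne_zero _) (congrArg Subtype.val h))

lemma rot_wave [NeZero Q] (j : Fin Q) : rot Q (wave j) = wave (j + 1) :=
  Subtype.ext (by rw [coe_rot, coe_wave, coe_wave, waveVec_add_one])

lemma symbol_rot [NeZero Q] (k : quasilattice Q) : symbol (rot Q k) = symbol k := by
  rw [symbol, symbol, coe_rot, norm_mul, (Complex.isPrimitiveRoot_exp Q (NeZero.ne Q)).norm'_eq_one
    (NeZero.ne Q), one_mul]

lemma RotInvariant.apply_of_eq_pow_mul [NeZero Q] {u : FourierSeries Q} (hu : RotInvariant u) (n : ℕ)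
    {k k' : quasilattice Q}
    (h : (k' : ℂ) = Complex.exp (2 * Real.pi * Complex.I / (Q : ℂ)) ^ n * k) : u k' = u k := by
  induction n generalizing k' with
  | zero => rw [show k' = k from Subtype.ext (by simpa using h)]
  | succ n ih =>
    -- The intermediate points of the orbit must lie in the quasilattice before invariance applies
    -- to them.
    have hn : ∃ k'' : quasilattice Q,
        (k'' : ℂ) = Complex.exp (2 * Real.pi * Complex.I / (Q : ℂ)) ^ n * k := by
      clear ih h
      induction n with
      | zero => exact ⟨k, by simp⟩
      | succ n ih =>
        obtain ⟨k₁, h₁⟩ := ih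
        exact ⟨rot Q k₁, by rw [coe_rot, h₁, pow_succ']; ring⟩
    obtain ⟨k'', hk''⟩ := hn
    rw [← ih hk'']
    exact hu _ _ (by rw [h, hk'', pow_succ']; ring)

lemma RotInvariant.apply_wave [NeZero Q] {u : FourierSeries Q} (hu : RotInvariant u) (j : Fin Q) :
    u (wave j) = u (wave 0) :=
  hu.apply_of_eq_pow_mul j (by simp [waveVec_eq_pow])

/-- For even Q, the rotation applied Q/2 times is -1: its multiplier is a square root of 1 other
than 1. -/
lemma RotInvariant.apply_neg [NeZero Q] (hQ : Even Q) {u : FourierSeries Q} (hu : RotInvariant u)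
    {k k' : quasilattice Q} (h : (k' : ℂ) = -k) : u k' = u k := by
  obtain ⟨n, hn⟩ := hQ
  refine hu.apply_of_eq_pow_mul n ?_
  have hpr := Complex.isPrimitiveRoot_exp Q (NeZero.ne Q)
  have hpos := NeZero.pos Q
  have h1 := hpr.pow_ne_one_of_pos_of_lt (l := n) (by omega) (by omega)
  have h2 : (Complex.exp (2 * Real.pi * Complex.I / (Q : ℂ)) ^ n) ^ 2 = 1 := by
    rw [← pow_mul, show n * 2 = Q by omega, hpr.pow_eq_one]
  have h3 := (mul_eq_zero.1 (show (Complex.exp (2 * Real.pi * Complex.I / (Q : ℂ)) ^ n - 1) *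
    (Complex.exp (2 * Real.pi * Complex.I / (Q : ℂ)) ^ n + 1) = 0 by linear_combination h2)).resolve_left
    (sub_ne_zero.2 h1)
  rw [h]
  linear_combination -(k : ℂ) * h3

lemma RotInvariant.sub {u v : FourierSeries Q} (hu : RotInvariant u) (hv : RotInvariant v) :
    RotInvariant (u - v) := fun k k' h => by
  rw [Pi.sub_apply, Pi.sub_apply, hu k k' h, hv k k' h]

lemma RotInvariant.smul {u : FourierSeries Q} (hu : RotInvariant u) (c : ℂ) :
    RotInvariant (c • u) := fun k k' h => by
  rw [Pi.smul_apply, Pi.smul_apply, hu k k' h]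

/-- The action of the rotation on trigonometric polynomials. -/
def rotHom (Q : ℕ) [NeZero Q] : TrigPoly Q →+* TrigPoly Q :=
  AddMonoidAlgebra.mapDomainRingHom ℂ (rot Q)

lemma coeff_rotHom_rot [NeZero Q] (a : TrigPoly Q) (k : quasilattice Q) :
    (rotHom Q a).coeff (rot Q k) = a.coeff k :=
  Finsupp.mapDomain_apply rot_injective _ _

lemma rotInvariant_of_rotHom_eq [NeZero Q] {a : TrigPoly Q} (h : rotHom Q a = a) :
    RotInvariant (toFourier a) := by
  intro k k' hk
  have : k' = rot Q k := Subtype.ext hk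
  rw [this, toFourier_apply, toFourier_apply, ← coeff_rotHom_rot a k, h]

lemma rotHom_leadingPoly [NeZero Q] : rotHom Q (leadingPoly Q) = leadingPoly Q := by
  rw [leadingPoly, map_sum]
  simp only [rotHom, AddMonoidAlgebra.mapDomainRingHom_apply, AddMonoidAlgebra.mapDomain_single,
    rot_wave]
  exact Equiv.sum_comp (Equiv.addRight (1 : Fin Q)) fun j => AddMonoidAlgebra.single (wave j) (1 : ℂ)

lemma rotHom_diagOp [NeZero Q] {f : quasilattice Q → ℂ} (hf : ∀ k, f (rot Q k) = f k)
    (a : TrigPoly Q) : rotHom Q (diagOp f a) = diagOp f (rotHom Q a) := by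
  ext k
  by_cases hk : k ∈ Set.range (rot Q)
  · obtain ⟨k, rfl⟩ := hk
    rw [coeff_rotHom_rot, coeff_diagOp, coeff_diagOp, coeff_rotHom_rot, hf]
  · have h0 : ∀ b : TrigPoly Q, (rotHom Q b).coeff k = 0 := fun b =>
      Finsupp.mapDomain_of_notMem_range _ _ hk
    rw [coeff_diagOp, h0, h0, mul_zero]

lemma waveVec_injective [NeZero Q] : Function.Injective (waveVec Q) := fun i j h => by
  rw [waveVec_eq_pow, waveVec_eq_pow] at h
  exact Fin.ext ((Complex.isPrimitiveRoot_exp Q (NeZero.ne Q)).pow_inj i.2 j.2 h)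

/-- Invariant trigonometric polynomials in the kernel of `(1 + Δ) ^ 2` are multiples of the leading
one. -/
lemma eq_smul_leadingPoly [NeZero Q] (hQ : Even Q) {a : TrigPoly Q}
    (ha : RotInvariant (toFourier a)) (hL : opL a = 0) :
    a = a.coeff (wave 0) • leadingPoly Q := by
  classical
  have hinj : Function.Injective (wave (Q := Q)) := fun _ _ h =>
    waveVec_injective (congrArg Subtype.val h)
  ext k
  rw [AddMonoidAlgebra.coeff_smul_apply, ← toFourier_apply (leadingPoly Q), toFourier_leadingPoly,
    leading, Finset.sum_apply]
  simp only [mode_apply]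
  by_cases hk : symbol k = 0
  · obtain ⟨j, rfl⟩ := exists_eq_wave_of_symbol_eq_zero hQ hk
    simp only [hinj.eq_iff, Finset.sum_ite_eq', Finset.mem_univ, if_true, smul_eq_mul, mul_one]
    exact ha.apply_wave j
  · have h1 : (opL a).coeff k = 0 := by rw [hL]; rfl
    rw [coeff_opL, mul_eq_zero, Complex.ofReal_eq_zero, or_iff_right hk] at h1
    rw [h1, Finset.sum_eq_zero, smul_zero]
    intro j _
    rw [if_neg]
    rintro rfl
    exact hk (symbol_wave j)

/-- Solvability: an invariant trigonometric polynomial with zero mean on the kernel. -/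
lemma opL_opLInv [NeZero Q] (hQ : Even Q) {a : TrigPoly Q}
    (ha : RotInvariant (toFourier a)) (h0 : a.coeff (wave 0) = 0) : opL (opLInv a) = a := by
  ext k
  rw [coeff_opL, coeff_opLInv]
  by_cases hk : symbol k = 0
  · obtain ⟨j, rfl⟩ := exists_eq_wave_of_symbol_eq_zero hQ hk
    rw [hk, ← toFourier_apply a, ha.apply_wave j, toFourier_apply, h0]
    simp
  · rw [mul_inv_cancel_left₀ (Complex.ofReal_ne_zero.2 hk)]

lemma opL_leadingPoly : opL (leadingPoly Q) = 0 := by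
  ext k
  rw [coeff_opL]
  by_cases hk : ∃ j, wave j = k
  · obtain ⟨j, rfl⟩ := hk
    simp [symbol_wave]
  · have : (leadingPoly Q).coeff k = 0 := by
      classical
      rw [leadingPoly, AddMonoidAlgebra.coeff_sum, Finsupp.finsetSum_apply]
      refine Finset.sum_eq_zero fun j _ => ?_
      rw [AddMonoidAlgebra.coeff_single, Finsupp.single_apply, if_neg fun h => hk ⟨j, h⟩]
    simp [this]

end Rotation

/-! ### Real-valuedness -/

section Conj

variable {Q : ℕ}

/-- Complex conjugation of the Fourier coefficients. -/
def conjHom (Q : ℕ) : TrigPoly Q →+* TrigPoly Q :=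
  AddMonoidAlgebra.mapRingHom (quasilattice Q) (starRingEnd ℂ)

@[simp] lemma coeff_conjHom (a : TrigPoly Q) (k : quasilattice Q) :
    (conjHom Q a).coeff k = conj (a.coeff k) := by simp [conjHom]

lemma conjHom_leadingPoly : conjHom Q (leadingPoly Q) = leadingPoly Q := by
  rw [leadingPoly, map_sum]
  simp [conjHom]

/-- `conjHom` does not reflect k, but invariance already makes the coefficients even in k, so real
coefficients suffice. -/
lemma isRealValued_of_conjHom_eq [NeZero Q] (hQ : Even Q) {a : TrigPoly Q}
    (hr : RotInvariant (toFourier a)) (h : conjHom Q a = a) : IsRealValued (toFourier a) := by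
  intro k k' hk
  rw [hr.apply_neg hQ hk, toFourier_apply, ← coeff_conjHom, h]

end Conj

/-! ### Resonant triples and the value of β -/

section Resonance

variable {Q : ℕ}

lemma waveVec_zero [NeZero Q] : waveVec Q 0 = 1 := by simp [waveVec_eq_pow]

lemma exists_waveVec_eq_neg [NeZero Q] (hQ : Even Q) (j : Fin Q) :
    ∃ j', waveVec Q j' = -waveVec Q j := by
  have h1 : (-waveVec Q j) ^ Q = 1 := by
    rw [hQ.neg_pow, waveVec_eq_pow, pow_right_comm, exp_pow_eq_one, one_pow]
  obtain ⟨i, hi, hi'⟩ := (Complex.isPrimitiveRoot_exp Q (NeZero.ne Q)).eq_pow_of_pow_eq_one h1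
  exact ⟨⟨i, hi⟩, by rw [waveVec_eq_pow, ← hi']⟩

/-- Three unit numbers that add up to `1`: one is `1` and the other two are opposite. -/
lemma resonance {a b c : ℂ} (ha : ‖a‖ = 1) (hb : ‖b‖ = 1) (hc : ‖c‖ = 1) :
    a + b + c = 1 ↔ (a = 1 ∧ c = -b) ∨ (b = 1 ∧ c = -a) ∨ (c = 1 ∧ b = -a) := by
  constructor
  · intro h
    have hn : ∀ z : ℂ, ‖z‖ = 1 → z * conj z = 1 := fun z hz => by
      rw [Complex.mul_conj, Complex.normSq_eq_norm_sq, hz]; simp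
    have h' : conj a + conj b + conj c = 1 := by
      rw [← map_add, ← map_add, h, map_one]
    -- Conjugates of unit numbers are inverses, so conjugating the sum gives e₂ = e₃; with e₁ = 1
    -- this makes (1 - a)(1 - b)(1 - c) vanish.
    have h2 : b * c + a * c + a * b = a * b * c := by
      linear_combination (a * b * c) * h' - b * c * hn a ha - a * c * hn b hb - a * b * hn c hc
    have h3 : (1 - a) * ((1 - b) * (1 - c)) = 0 := by linear_combination h2 - h
    rcases mul_eq_zero.1 h3 with h4 | h4
    · exact Or.inl ⟨by linear_combination -h4, by linear_combination h + h4⟩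
    rcases mul_eq_zero.1 h4 with h4 | h4
    · exact Or.inr (Or.inl ⟨by linear_combination -h4, by linear_combination h + h4⟩)
    · exact Or.inr (Or.inr ⟨by linear_combination -h4, by linear_combination h + h4⟩)
  · rintro (⟨rfl, rfl⟩ | ⟨rfl, rfl⟩ | ⟨rfl, rfl⟩) <;> ring

lemma coeff_leadingPoly_cube [NeZero Q] (hQ : Even Q) :
    (leadingPoly Q ^ 3).coeff (wave 0) = (beta Q : ℂ) := by
  classical
  choose ν hν using exists_waveVec_eq_neg hQ
  have hsum : (leadingPoly Q ^ 3).coeff (wave 0) = ∑ i : Fin Q, ∑ j : Fin Q, ∑ l : Fin Q,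
      if waveVec Q i + waveVec Q j + waveVec Q l = 1 then (1 : ℂ) else 0 := by
    rw [pow_three', leadingPoly, Finset.sum_mul_sum, Finset.sum_mul, AddMonoidAlgebra.coeff_sum,
      Finsupp.finsetSum_apply]
    refine Finset.sum_congr rfl fun i _ => ?_
    rw [Finset.sum_mul_sum, AddMonoidAlgebra.coeff_sum, Finsupp.finsetSum_apply]
    refine Finset.sum_congr rfl fun j _ => ?_
    rw [AddMonoidAlgebra.coeff_sum, Finsupp.finsetSum_apply]
    refine Finset.sum_congr rfl fun l _ => ?_
    rw [AddMonoidAlgebra.single_mul_single, AddMonoidAlgebra.single_mul_single,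
      AddMonoidAlgebra.coeff_single, Finsupp.single_apply]
    simp [Subtype.ext_iff, waveVec_zero (Q := Q)]
  have hone : ∀ i, waveVec Q i = 1 ↔ i = 0 := fun i => by
    rw [← waveVec_zero (Q := Q), waveVec_injective.eq_iff]
  have hneg : ∀ i j, waveVec Q i = -waveVec Q j ↔ i = ν j := fun i j => by
    rw [← hν, waveVec_injective.eq_iff]
  have hνν : ∀ i, ν (ν i) = i := fun i => waveVec_injective (by rw [hν, hν, neg_neg])
  have hν0 : ∀ i, ν i ≠ i := fun i h => by
    have h1 := hν i
    rw [h, self_eq_neg] at h1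
    have := norm_waveVec i
    rw [h1, norm_zero] at this
    exact zero_ne_one this
  -- Inclusion–exclusion: there are three families of Q triples, any two share exactly one triple,
  -- and no triple lies in all three because k_1 is not its own opposite. The count is 3Q - 3.
  have hpt : ∀ i j l : Fin Q,
      (if waveVec Q i + waveVec Q j + waveVec Q l = 1 then (1 : ℂ) else 0) =
        (if i = 0 then if l = ν j then 1 else 0 else 0)
        + (if j = 0 then if l = ν i then 1 else 0 else 0)
        + (if l = 0 then if j = ν i then 1 else 0 else 0)
        - (if i = 0 then if j = 0 then if l = ν 0 then 1 else 0 else 0 else 0)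
        - (if i = 0 then if j = ν 0 then if l = 0 then 1 else 0 else 0 else 0)
        - (if i = ν 0 then if j = 0 then if l = 0 then 1 else 0 else 0 else 0) := by
    intro i j l
    rw [if_congr (resonance (norm_waveVec i) (norm_waveVec j) (norm_waveVec l)) rfl rfl]
    simp only [hone, hneg]
    have h0 := hν0 0
    by_cases hi : i = 0 <;> by_cases hj : j = 0 <;> by_cases hl : l = 0
    all_goals simp only [hi, hj, hl, true_and, false_and, if_true, if_false, or_false, false_or,
      h0.symm]
    all_goals grind
  rw [hsum]
  simp only [hpt, Finset.sum_sub_distrib, Finset.sum_add_distrib, Finset.sum_ite_irrel,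
    Finset.sum_ite_eq', Finset.mem_univ, if_true, Finset.sum_const_zero, Finset.sum_const,
    Finset.card_univ, Fintype.card_fin, nsmul_eq_mul, mul_one]
  rw [beta]
  push_cast
  ring

lemma coeff_leadingPoly_wave [NeZero Q] : (leadingPoly Q).coeff (wave 0) = 1 := by
  classical
  rw [leadingPoly, AddMonoidAlgebra.coeff_sum, Finsupp.finsetSum_apply]
  simp only [AddMonoidAlgebra.coeff_single, Finsupp.single_apply, Subtype.ext_iff, coe_wave,
    waveVec_injective.eq_iff, Finset.sum_ite_eq', Finset.mem_univ, if_true]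

end Resonance

open PowerSeries

/-! ### Cubes of power series -/

section Cube

variable {R : Type*} [CommRing R]

lemma coeff_cube_eq_of_lt {u v : R⟦X⟧} {n : ℕ} (h : ∀ i < n, coeff i u = coeff i v) :
    ∀ i < n, coeff i (u ^ 3) = coeff i (v ^ 3) := by
  intro i hi
  obtain ⟨e, he⟩ := (X_pow_dvd_iff (n := n) (φ := u - v)).2 fun i hi => by
    rw [map_sub, h i hi, sub_self]
  have : u ^ 3 - v ^ 3 = X ^ n * (e * (u ^ 2 + u * v + v ^ 2)) := by
    linear_combination (u ^ 2 + u * v + v ^ 2) * he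
  rw [← sub_eq_zero, ← map_sub, this, coeff_X_pow_mul', if_neg (by omega)]

/-- In u³ - v³ = (u - v)(u² + uv + v²) the first factor is divisible by Xⁿ and the second has
constant term 3 v₀². This linearisation drives both uniqueness and the choice of the amplitudes. -/
lemma coeff_cube_sub {u v : R⟦X⟧} {n : ℕ} (hn : n ≠ 0) (h : ∀ i < n, coeff i u = coeff i v) :
    coeff n (u ^ 3) - coeff n (v ^ 3) = 3 * coeff 0 v ^ 2 * (coeff n u - coeff n v) := by
  obtain ⟨e, he⟩ := (X_pow_dvd_iff (n := n) (φ := u - v)).2 fun i hi => by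
    rw [map_sub, h i hi, sub_self]
  have h3 : u ^ 3 - v ^ 3 = X ^ n * (e * (u ^ 2 + u * v + v ^ 2)) := by
    linear_combination (u ^ 2 + u * v + v ^ 2) * he
  have h0 := h 0 (Nat.pos_of_ne_zero hn)
  rw [← map_sub, ← map_sub, h3, he, coeff_X_pow_mul', coeff_X_pow_mul', if_pos le_rfl, if_pos le_rfl,
    Nat.sub_self]
  simp only [coeff_zero_eq_constantCoeff, map_mul, map_add, map_pow] at h0 ⊢
  rw [h0]
  ring

/-- With X standing for μ^(1/2), a series f in μ becomes the odd series X f(X²). -/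
lemma coeff_X_mul_expand (f : R⟦X⟧) (m : ℕ) :
    coeff m (X * expand 2 two_ne_zero f) = if Odd m then coeff (m / 2) f else 0 := by
  rcases m with _ | m
  · simp
  · rw [coeff_succ_X_mul, coeff_expand]
    have h1 : Odd (m + 1) ↔ 2 ∣ m := by rw [Nat.odd_add_one, Nat.not_odd_iff_even, even_iff_two_dvd]
    simp only [h1]
    split_ifs with h
    · rw [show (m + 1) / 2 = m / 2 by omega]
    · rfl

lemma expand_two_X : expand 2 two_ne_zero (X : R⟦X⟧) = X ^ 2 := by
  ext m
  rw [coeff_expand, coeff_X_pow]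
  split_ifs with h1 h2 h2
  · subst h2; simp
  · rw [coeff_X, if_neg (by omega)]
  · omega
  · rfl

end Cube

/-! ### Formal solutions: finite support and uniqueness -/

section Series

variable {Q : ℕ}

lemma formalSeries_mul_toFourier (v w : (TrigPoly Q)⟦X⟧) :
    FormalSeries.mul (fun m => toFourier (coeff m v)) (fun m => toFourier (coeff m w)) =
      fun m => toFourier (coeff m (v * w)) := by
  funext m
  rw [coeff_mul, map_sum, FormalSeries.mul]
  exact Finset.sum_congr rfl fun p _ => mul_toFourier _ _

lemma muMul_toFourier (v : (TrigPoly Q)⟦X⟧) (m : ℕ) :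
    FormalSeries.muMul (fun m => toFourier (coeff m v)) m = toFourier (coeff m (X ^ 2 * v)) := by
  rw [coeff_X_pow_mul']
  rcases m with _ | _ | m
  · simp [FormalSeries.muMul]
  · simp [FormalSeries.muMul]
  · simp [FormalSeries.muMul]

lemma isFormalSolution_toFourier_iff (w : (TrigPoly Q)⟦X⟧) :
    IsFormalSolution (fun m => toFourier (coeff m w)) ↔
      ∀ m, opL (coeff m w) - coeff m (X ^ 2 * w) + coeff m (w ^ 3) = 0 := by
  refine forall_congr' fun m => ?_
  rw [muMul_toFourier, formalSeries_mul_toFourier, formalSeries_mul_toFourier, L0_toFourier,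
    ← map_sub, ← map_add, map_eq_zero_iff _ toFourier_injective, pow_three']

/-- A formal solution with trigonometric polynomials as coefficients. -/
structure IsPolySolution [NeZero Q] (w : (TrigPoly Q)⟦X⟧) : Prop where
  rot : ∀ m, RotInvariant (toFourier (coeff m w))
  sol : ∀ m, opL (coeff m w) - coeff m (X ^ 2 * w) + coeff m (w ^ 3) = 0
  zero : coeff 0 w = 0
  one : ∃ a : ℝ, 0 < a ∧ coeff 1 w = (a : ℂ) • leadingPoly Q

lemma isQuasipatternSolution_toFourier_iff [NeZero Q] {s : ℝ} (w : (TrigPoly Q)⟦X⟧) :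
    IsQuasipatternSolution Q s (fun m => toFourier (coeff m w)) ↔ IsPolySolution w := by
  have h1 : ∀ a : ℝ, toFourier (coeff 1 w) = (a : ℂ) • leading Q ↔
      coeff 1 w = (a : ℂ) • leadingPoly Q := fun a => by
    rw [← toFourier_leadingPoly, ← map_smul, toFourier_injective.eq_iff]
  constructor
  · intro h
    obtain ⟨a, ha, ha'⟩ := h.one
    exact ⟨h.rot, (isFormalSolution_toFourier_iff w).1 h.sol,
      (map_eq_zero_iff _ toFourier_injective).1 h.zero, a, ha, (h1 a).1 ha'⟩
  · intro h
    obtain ⟨a, ha, ha'⟩ := h.one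
    exact ⟨fun _ => memH_toFourier _, h.rot, (isFormalSolution_toFourier_iff w).2 h.sol,
      (map_eq_zero_iff _ toFourier_injective).2 h.zero, a, ha, (h1 a).2 ha'⟩

lemma mul_zero_left (u : FourierSeries Q) : mul 0 u = 0 := by
  funext k; simp [mul]

lemma mul_zero_right (u : FourierSeries Q) : mul u 0 = 0 := by
  funext k; simp [mul]

lemma finite_support_mul {u v : FourierSeries Q} (hu : (Function.support u).Finite)
    (hv : (Function.support v).Finite) : (Function.support (mul u v)).Finite := by
  obtain ⟨a, rfl⟩ := exists_toFourier_eq hu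
  obtain ⟨b, rfl⟩ := exists_toFourier_eq hv
  rw [mul_toFourier]
  exact (a * b).coeff.hasFiniteSupport

lemma finite_support_sum {ι : Type*} {t : Finset ι} {f : ι → FourierSeries Q}
    (h : ∀ i ∈ t, (Function.support (f i)).Finite) :
    (Function.support (∑ i ∈ t, f i)).Finite := by
  refine (t.finite_toSet.biUnion h).subset fun k hk => ?_
  by_contra hc
  simp only [Finset.mem_coe, Set.mem_iUnion, Function.mem_support, not_exists, not_not] at hc
  exact hk (by rw [Finset.sum_apply]; exact Finset.sum_eq_zero hc)

/-- Formal solutions that vanish at `μ = 0` have trigonometric polynomials as coefficients. -/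
lemma finite_support_of_isFormalSolution [NeZero Q] (hQ : Even Q) {V : FormalSeries Q}
    (h0 : V 0 = 0) (h : IsFormalSolution V) (m : ℕ) : (Function.support (V m)).Finite := by
  induction m using Nat.strong_induction_on with
  | _ m ih =>
  have hcub : (Function.support (FormalSeries.mul (FormalSeries.mul V V) V m)).Finite := by
    refine finite_support_sum fun p hp => ?_
    have hp := Finset.HasAntidiagonal.mem_antidiagonal.1 hp
    -- Since V 0 = 0, the cubic term at order m contains no V m: its cofactor would be (V²)₀ = 0.
    by_cases hpm : p.2 = m
    · have : FormalSeries.mul V V p.1 = 0 := by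
        have hp1 : p.1 = 0 := by omega
        rw [hp1, FormalSeries.mul]
        simp [h0, mul_zero_left]
      rw [this, mul_zero_left]
      simp
    refine finite_support_mul (finite_support_sum fun q hq => ?_) (ih _ (by omega))
    have hq := Finset.HasAntidiagonal.mem_antidiagonal.1 hq
    by_cases h1 : q.1 = 0
    · rw [h1, h0, mul_zero_left]; simp
    by_cases h2 : q.2 = 0
    · rw [h2, h0, mul_zero_right]; simp
    exact finite_support_mul (ih _ (by omega)) (ih _ (by omega))
  have hmu : (Function.support (FormalSeries.muMul V m)).Finite := by
    rcases m with _ | _ | m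
    · simp [FormalSeries.muMul]
    · simp [FormalSeries.muMul]
    · exact ih m (by omega)
  refine ((hcub.union hmu).union (Set.finite_range (wave (Q := Q)))).subset fun k hk => ?_
  -- Off the finitely many wavevectors the symbol can be divided out, so V m is supported where the
  -- lower-order terms are.
  by_cases hs : symbol k = 0
  · obtain ⟨j, hj⟩ := exists_eq_wave_of_symbol_eq_zero hQ hs
    exact Or.inr ⟨j, hj.symm⟩
  · refine Or.inl ?_
    by_contra hc
    simp only [Set.mem_union, Function.mem_support, not_or, not_not] at hc
    have := congrFun (h m) k
    rw [Pi.add_apply, Pi.sub_apply, hc.1, hc.2, L0, sub_zero, add_zero, Pi.zero_apply,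
      mul_eq_zero, Complex.ofReal_eq_zero] at this
    exact this.elim hs hk

lemma coeff_wave_opL [NeZero Q] (a : TrigPoly Q) : (opL a).coeff (wave 0) = 0 := by
  rw [coeff_opL, symbol_wave]; simp

lemma beta_pos (hQ : 1 < Q) : 0 < beta Q := by
  have : (1 : ℝ) < Q := mod_cast hQ
  rw [beta]; linarith

/-- After division by X, solvability at lowest order reads a = a³ β, which fixes a > 0. At a later
order two solutions differ by a kernel element c · U⁽⁰⁾, and the linearised condition c = 3 a² β c =
3c forces c = 0. -/
lemma IsPolySolution.unique [NeZero Q] (hQ : Even Q) (hQ1 : 1 < Q) {w w' : (TrigPoly Q)⟦X⟧}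
    (h : IsPolySolution w) (h' : IsPolySolution w') : w = w' := by
  have key : ∀ {w : (TrigPoly Q)⟦X⟧}, IsPolySolution w → ∃ v : (TrigPoly Q)⟦X⟧, w = X * v ∧
      (∀ m, RotInvariant (toFourier (coeff m v))) ∧
      (∀ m, opL (coeff m v) = coeff (m + 1) (X ^ 3 * (v - v ^ 3))) ∧
      (∀ m, (coeff m v).coeff (wave 0) = (coeff m (v ^ 3)).coeff (wave 0)) ∧
      ∃ a : ℝ, 0 < a ∧ coeff 0 v = (a : ℂ) • leadingPoly Q ∧ a ^ 2 * beta Q = 1 := by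
    intro w h
    obtain ⟨v, rfl⟩ := X_dvd_iff.2 (by simpa using h.zero)
    have hsol : ∀ m, opL (coeff m v) = coeff (m + 1) (X ^ 3 * (v - v ^ 3)) := by
      intro m
      have := h.sol (m + 1)
      rw [coeff_succ_X_mul, show X ^ 2 * (X * v) = X ^ 3 * v by ring, mul_pow] at this
      rw [mul_sub, map_sub]
      linear_combination this
    -- The condition on coefficient m comes from the equation for coefficient m + 2, because L has
    -- no component on the wavevectors.
    have hp : ∀ m, (coeff m v).coeff (wave 0) = (coeff m (v ^ 3)).coeff (wave 0) := by
      intro m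
      have h1 := coeff_wave_opL (coeff (m + 2) v)
      rw [hsol, coeff_X_pow_mul', if_pos (by omega), show m + 2 + 1 - 3 = m by omega, map_sub,
        AddMonoidAlgebra.coeff_sub, Finsupp.sub_apply, sub_eq_zero] at h1
      exact h1
    obtain ⟨a, ha, ha'⟩ := h.one
    rw [show (1 : ℕ) = 0 + 1 from rfl, coeff_succ_X_mul] at ha'
    refine ⟨v, rfl, fun m => ?_, hsol, hp, a, ha, ha', ?_⟩
    · have := h.rot (m + 1)
      rwa [coeff_succ_X_mul] at this
    · have h0 := hp 0
      rw [coeff_zero_eq_constantCoeff, map_pow, ← coeff_zero_eq_constantCoeff, ha', smul_pow,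
        AddMonoidAlgebra.coeff_smul_apply, AddMonoidAlgebra.coeff_smul_apply,
        coeff_leadingPoly_cube hQ, coeff_leadingPoly_wave, smul_eq_mul, smul_eq_mul, mul_one] at h0
      have h1 : a = a ^ 3 * beta Q := by exact_mod_cast h0
      have h2 : a * (a ^ 2 * beta Q - 1) = 0 := by linear_combination -h1
      linarith [(mul_eq_zero.1 h2).resolve_left ha.ne']
  obtain ⟨v, rfl, hr, hsol, hp, a, ha, hv0, hab⟩ := key h
  obtain ⟨v', rfl, hr', hsol', hp', a', ha', hv0', hab'⟩ := key h'
  congr 1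
  ext1 m
  induction m using Nat.strong_induction_on with
  | _ m ih =>
  rcases Nat.eq_zero_or_pos m with rfl | hm
  · have hβ := beta_pos hQ1
    have : a ^ 2 = a' ^ 2 := mul_right_cancel₀ hβ.ne' (hab.trans hab'.symm)
    rw [hv0, hv0', (pow_left_inj₀ ha.le ha'.le two_ne_zero).1 this]
  have hker : opL (coeff m v - coeff m v') = 0 := by
    rw [map_sub, hsol, hsol', coeff_X_pow_mul', coeff_X_pow_mul']
    split_ifs with h3
    · have hlt : m + 1 - 3 < m := by omega
      rw [map_sub, map_sub, ih _ hlt, coeff_cube_eq_of_lt ih _ hlt, sub_self]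
    · rw [sub_self]
  have hd := eq_smul_leadingPoly hQ (by rw [map_sub]; exact (hr m).sub (hr' m)) hker
  set c := (coeff m v - coeff m v').coeff (wave 0) with hc
  have h1 : c = (coeff m (v ^ 3) - coeff m (v' ^ 3)).coeff (wave 0) := by
    rw [hc, AddMonoidAlgebra.coeff_sub, AddMonoidAlgebra.coeff_sub, Finsupp.sub_apply,
      Finsupp.sub_apply, hp, hp']
  have h2 : 3 * ((a' : ℂ) • leadingPoly Q) ^ 2 * (c • leadingPoly Q) =
      (3 * (a' : ℂ) ^ 2 * c) • leadingPoly Q ^ 3 := by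
    simp only [Algebra.smul_def, map_mul, map_pow, map_ofNat]
    ring
  rw [coeff_cube_sub hm.ne' ih, hd, hv0', h2, AddMonoidAlgebra.coeff_smul_apply,
    coeff_leadingPoly_cube hQ, smul_eq_mul] at h1
  have h3 : (a' : ℂ) ^ 2 * (beta Q : ℂ) = 1 := by exact_mod_cast hab'
  have h4 : c = 0 := by linear_combination (-1 / 2) * h1 - (3 / 2) * c * h3
  rw [h4, zero_smul] at hd
  exact sub_eq_zero.1 hd

end Series

/-! ### Recursive construction of the solution -/

section Construction

variable {Q : ℕ}

/-- The component off the kernel of the next coefficient, given the truncation `S` at order `n`. -/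
def nextW (S : (TrigPoly Q)⟦X⟧) (n : ℕ) : TrigPoly Q :=
  opLInv (coeff n S - (beta Q : ℂ)⁻¹ • coeff n (S ^ 3))

/-- The amplitude of the next coefficient, given the truncation `S` at order `n`. -/
def nextB [NeZero Q] (S : (TrigPoly Q)⟦X⟧) (n : ℕ) : ℂ :=
  -- This solves b = β⁻¹ (t + 3 β b), where t is the contribution to the cube on k_1 that does not
  -- contain b.
  -(2 * (beta Q : ℂ))⁻¹ *
    (coeff (n + 1) (S ^ 3) + 3 * leadingPoly Q ^ 2 * nextW S n).coeff (wave 0)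

/-- The truncation at order `n` of the amplitude expansion. -/
def truncSol (Q : ℕ) [NeZero Q] : ℕ → (TrigPoly Q)⟦X⟧
  | 0 => C (leadingPoly Q)
  | n + 1 => truncSol Q n +
      monomial (n + 1) (nextB (truncSol Q n) n • leadingPoly Q + nextW (truncSol Q n) n)

/-- The component of the coefficients off the kernel. -/
def solW (Q : ℕ) [NeZero Q] : ℕ → TrigPoly Q
  | 0 => 0
  | n + 1 => nextW (truncSol Q n) n

/-- The amplitude of the coefficients along the leading one. -/
def solB (Q : ℕ) [NeZero Q] : ℕ → ℂ
  | 0 => 1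
  | n + 1 => nextB (truncSol Q n) n

/-- The amplitude expansion `∑ n, μ ^ n U⁽ⁿ⁾`. -/
def solU (Q : ℕ) [NeZero Q] : (TrigPoly Q)⟦X⟧ := mk fun n => solB Q n • leadingPoly Q + solW Q n

lemma coeff_solU [NeZero Q] (n : ℕ) :
    coeff n (solU Q) = solB Q n • leadingPoly Q + solW Q n := coeff_mk _ _

lemma coeff_zero_solU [NeZero Q] : coeff 0 (solU Q) = leadingPoly Q := by
  rw [coeff_solU, solB, solW, one_smul, add_zero]

lemma coeff_truncSol [NeZero Q] (n i : ℕ) :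
    coeff i (truncSol Q n) = if i ≤ n then coeff i (solU Q) else 0 := by
  induction n with
  | zero =>
    rw [truncSol, coeff_C]
    by_cases h : i = 0
    · subst h; simp [coeff_zero_solU]
    · simp [h]
  | succ n ih =>
    rw [truncSol, map_add, ih, coeff_monomial]
    by_cases h : i = n + 1
    · subst h
      simp [coeff_solU, solB, solW]
    · rw [if_neg h, add_zero]
      exact if_congr (by omega) rfl rfl

lemma coeff_truncSol_of_le [NeZero Q] {n i : ℕ} (h : i ≤ n) :
    coeff i (truncSol Q n) = coeff i (solU Q) := by rw [coeff_truncSol, if_pos h]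

lemma coeff_solW_wave [NeZero Q] (n : ℕ) (j : Fin Q) : (solW Q n).coeff (wave j) = 0 := by
  cases n with
  | zero => rfl
  | succ n => rw [solW, nextW, coeff_opLInv, symbol_wave]; simp

lemma solW_succ [NeZero Q] (n : ℕ) : solW Q (n + 1) =
    opLInv (coeff n (solU Q) - (beta Q : ℂ)⁻¹ • coeff n (solU Q ^ 3)) := by
  rw [solW, nextW, coeff_truncSol_of_le le_rfl,
    coeff_cube_eq_of_lt (v := solU Q) (fun i hi => coeff_truncSol_of_le (Nat.lt_succ_iff.1 hi)) n
      n.lt_succ_self]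

/-- The recursion commutes with any symmetry of its data; rotation (σ the identity) and conjugation
are the two uses. In `h4` only fixed polynomials are considered, since a rotation moves the
wavevector k_1. -/
lemma map_truncSol [NeZero Q] {φ : TrigPoly Q →+* TrigPoly Q} {σ : ℂ →+* ℂ}
    (h1 : φ (leadingPoly Q) = leadingPoly Q) (h2 : ∀ a, φ (opLInv a) = opLInv (φ a))
    (h3 : ∀ (c : ℂ) a, φ (c • a) = σ c • φ a)
    (h4 : ∀ a, φ a = a → σ (a.coeff (wave 0)) = a.coeff (wave 0)) (h5 : σ (beta Q) = beta Q)
    (n : ℕ) : map φ (truncSol Q n) = truncSol Q n ∧ φ (solW Q n) = solW Q n ∧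
      σ (solB Q n) = solB Q n := by
  have key : ∀ S : (TrigPoly Q)⟦X⟧, map φ S = S → ∀ n, φ (nextW S n) = nextW S n ∧
      σ (nextB S n) = nextB S n := by
    intro S hS n
    have hc : ∀ i, φ (coeff i S) = coeff i S := fun i => by
      conv_rhs => rw [← hS, coeff_map]
    have hc3 : ∀ i, φ (coeff i (S ^ 3)) = coeff i (S ^ 3) := fun i => by
      conv_rhs => rw [← hS, ← map_pow, coeff_map]
    have hW : φ (nextW S n) = nextW S n := by
      rw [nextW, h2, map_sub, h3, hc, hc3, map_inv₀, h5]
    refine ⟨hW, ?_⟩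
    rw [nextB, map_mul, map_neg, map_inv₀, map_mul, h5, map_ofNat, h4]
    rw [map_add, hc3, map_mul, map_mul, map_pow φ, map_ofNat, hW, h1]
  have hS : ∀ n, map φ (truncSol Q n) = truncSol Q n := by
    intro n
    induction n with
    | zero => rw [truncSol, map_C, h1]
    | succ n ih =>
      obtain ⟨hW, hB⟩ := key _ ih n
      rw [truncSol, map_add, ih]
      congr 1
      ext1 i
      rw [coeff_map, coeff_monomial]
      split_ifs
      · rw [map_add, h3, hB, hW, h1]
      · rw [map_zero]
  refine ⟨hS n, ?_⟩
  cases n with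
  | zero => exact ⟨map_zero _, map_one _⟩
  | succ n => exact key _ (hS n) n

lemma rotHom_smul [NeZero Q] (c : ℂ) (a : TrigPoly Q) : rotHom Q (c • a) = c • rotHom Q a :=
  congrArg AddMonoidAlgebra.ofCoeff (Finsupp.mapDomain_smul c a.coeff)

lemma rotHom_solW [NeZero Q] (n : ℕ) : rotHom Q (solW Q n) = solW Q n :=
  (map_truncSol (σ := RingHom.id ℂ) rotHom_leadingPoly
    (rotHom_diagOp fun k => by rw [symbol_rot]) rotHom_smul (fun _ _ => rfl) rfl n).2.1

lemma conjHom_solW_and_conj_solB [NeZero Q] (n : ℕ) :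
    conjHom Q (solW Q n) = solW Q n ∧ conj (solB Q n) = solB Q n := by
  refine (map_truncSol (σ := starRingEnd ℂ) conjHom_leadingPoly (fun a => ?_) (fun c a => ?_)
    (fun a ha => ?_) (Complex.conj_ofReal _) n).2
  · ext k
    simp [coeff_opLInv]
  · ext k
    simp
  · rw [← coeff_conjHom, ha]

lemma rotHom_coeff_solU [NeZero Q] (n : ℕ) : rotHom Q (coeff n (solU Q)) = coeff n (solU Q) := by
  rw [coeff_solU, map_add, rotHom_smul, rotHom_solW, rotHom_leadingPoly]

lemma rotInvariant_coeff_solU [NeZero Q] (n : ℕ) : RotInvariant (toFourier (coeff n (solU Q))) :=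
  rotInvariant_of_rotHom_eq (rotHom_coeff_solU n)

lemma isRealValued_coeff_solU [NeZero Q] (hQ : Even Q) (n : ℕ) :
    IsRealValued (toFourier (coeff n (solU Q))) := by
  refine isRealValued_of_conjHom_eq hQ (rotInvariant_coeff_solU n) ?_
  obtain ⟨h1, h2⟩ := conjHom_solW_and_conj_solB (Q := Q) n
  rw [coeff_solU, map_add, h1]
  congr 1
  ext k
  rw [coeff_conjHom, AddMonoidAlgebra.coeff_smul_apply, smul_eq_mul, map_mul, h2, ← coeff_conjHom,
    conjHom_leadingPoly]

/-- By `opL_opLInv`, only the component on k_1 has to vanish. At order 0 it does by the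
normalisation β, and afterwards by the choice of `nextB`. -/
lemma opL_coeff_solU_succ [NeZero Q] (hQ : Even Q) (hQ1 : 1 < Q) (n : ℕ) :
    opL (coeff (n + 1) (solU Q)) =
      coeff n (solU Q) - (beta Q : ℂ)⁻¹ • coeff n (solU Q ^ 3) := by
  have hβ : (beta Q : ℂ) ≠ 0 := Complex.ofReal_ne_zero.2 (beta_pos hQ1).ne'
  rw [coeff_solU, map_add, map_smul, opL_leadingPoly, smul_zero, zero_add, solW_succ]
  refine opL_opLInv hQ (rotInvariant_of_rotHom_eq ?_) ?_
  · have h : map (rotHom Q) (solU Q) = solU Q := by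
      ext1 i
      rw [coeff_map, rotHom_coeff_solU]
    rw [map_sub, rotHom_smul, rotHom_coeff_solU, ← coeff_map, map_pow, h]
  · rw [AddMonoidAlgebra.coeff_sub, Finsupp.sub_apply, AddMonoidAlgebra.coeff_smul_apply,
      smul_eq_mul]
    cases n with
    | zero =>
      rw [coeff_zero_eq_constantCoeff, map_pow, ← coeff_zero_eq_constantCoeff, coeff_zero_solU,
        coeff_leadingPoly_cube hQ, coeff_leadingPoly_wave, inv_mul_cancel₀ hβ, sub_self]
    | succ n =>
      -- The truncation has zero coefficient at n + 1, so the comparison isolates the part of the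
      -- cube that is linear in the new coefficient.
      have h1 := coeff_cube_sub (u := solU Q) (v := truncSol Q n) n.succ_ne_zero
        fun i hi => (coeff_truncSol_of_le (Nat.lt_succ_iff.1 hi)).symm
      rw [coeff_truncSol n (n + 1), if_neg (by omega), coeff_truncSol_of_le n.zero_le,
        coeff_zero_solU, sub_zero, sub_eq_iff_eq_add] at h1
      have hb : solB Q (n + 1) = -(2 * (beta Q : ℂ))⁻¹ * (coeff (n + 1) (truncSol Q n ^ 3) +
          3 * leadingPoly Q ^ 2 * solW Q (n + 1)).coeff (wave 0) := rfl
      have h2 : coeff (n + 1) (solU Q ^ 3) = (coeff (n + 1) (truncSol Q n ^ 3) +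
          3 * leadingPoly Q ^ 2 * solW Q (n + 1)) +
          (3 * solB Q (n + 1)) • leadingPoly Q ^ 3 := by
        rw [h1, coeff_solU]
        simp only [Algebra.smul_def, map_mul, map_ofNat]
        ring
      rw [h2, AddMonoidAlgebra.coeff_add, Finsupp.add_apply, AddMonoidAlgebra.coeff_smul_apply,
        coeff_leadingPoly_cube hQ, coeff_solU, AddMonoidAlgebra.coeff_add, Finsupp.add_apply,
        AddMonoidAlgebra.coeff_smul_apply, coeff_leadingPoly_wave, coeff_solW_wave, smul_eq_mul,
        smul_eq_mul]
      generalize (coeff (n + 1) (truncSol Q n ^ 3) +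
          3 * leadingPoly Q ^ 2 * solW Q (n + 1)).coeff (wave 0) = t at hb
      rw [hb]
      field_simp
      ring

/-- The formal solution in powers of `μ ^ (1 / 2)`. -/
def halfSol (Q : ℕ) [NeZero Q] : (TrigPoly Q)⟦X⟧ :=
  C (algebraMap ℂ (TrigPoly Q) ((Real.sqrt (beta Q))⁻¹ : ℝ)) * (X * expand 2 two_ne_zero (solU Q))

lemma coeff_halfSol [NeZero Q] (m : ℕ) : coeff m (halfSol Q) =
    if Odd m then (((Real.sqrt (beta Q))⁻¹ : ℝ) : ℂ) • coeff (m / 2) (solU Q) else 0 := by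
  rw [halfSol, coeff_C_mul, coeff_X_mul_expand, mul_ite, mul_zero, Algebra.smul_def]

lemma amplitudeSeries_eq [NeZero Q] :
    amplitudeSeries (fun n => toFourier (coeff n (solU Q))) =
      fun m => toFourier (coeff m (halfSol Q)) := by
  funext m
  rw [amplitudeSeries, coeff_halfSol]
  split_ifs
  · rw [map_smul]
  · rw [map_zero]

lemma isPolySolution_halfSol [NeZero Q] (hQ : Even Q) (hQ1 : 1 < Q) :
    IsPolySolution (halfSol Q) := by
  have hβ := beta_pos hQ1
  refine ⟨fun m => ?_, fun m => ?_, ?_, ?_⟩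
  · rw [coeff_halfSol]
    split_ifs
    · rw [map_smul]
      exact (rotInvariant_coeff_solU _).smul _
    · rw [map_zero]
      exact fun _ _ _ => rfl
  · set c : ℂ := (((Real.sqrt (beta Q))⁻¹ : ℝ) : ℂ) with hc
    -- The prefactor β^(-1/2) turns the cubic term into β⁻¹ U³ once it is factored out; only odd
    -- orders survive.
    have hc2 : c ^ 2 = (beta Q : ℂ)⁻¹ := by
      rw [hc, ← Complex.ofReal_pow, inv_pow, Real.sq_sqrt hβ.le, Complex.ofReal_inv]
    have e1 : X ^ 2 * halfSol Q =
        C (algebraMap ℂ (TrigPoly Q) c) * (X * expand 2 two_ne_zero (X * solU Q)) := by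
      rw [halfSol, map_mul, expand_two_X]
      ring
    have e2 : halfSol Q ^ 3 = C (algebraMap ℂ (TrigPoly Q) c) *
        (X * expand 2 two_ne_zero (C (algebraMap ℂ (TrigPoly Q) (beta Q : ℂ)⁻¹) *
          (X * solU Q ^ 3))) := by
      rw [halfSol, map_mul, map_mul, map_pow, expand_two_X, expand_C, ← hc2, map_pow, map_pow]
      ring
    rw [e1, e2, coeff_C_mul, coeff_C_mul, coeff_X_mul_expand, coeff_X_mul_expand, coeff_halfSol]
    split_ifs
    · rw [map_smul, ← Algebra.smul_def, ← Algebra.smul_def, ← smul_sub, ← smul_add]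
      convert smul_zero c
      cases m / 2 with
      | zero => simp [coeff_zero_solU, opL_leadingPoly]
      | succ n =>
        rw [opL_coeff_solU_succ hQ hQ1, coeff_C_mul, coeff_succ_X_mul, coeff_succ_X_mul,
          ← Algebra.smul_def]
        abel
    · simp
  · rw [coeff_halfSol, if_neg (by simp)]
  · exact ⟨_, inv_pos.2 (Real.sqrt_pos.2 hβ), by
      rw [coeff_halfSol, if_pos odd_one, Nat.div_eq_of_lt one_lt_two, coeff_zero_solU]⟩

end Construction

/-! ### The ℓ¹ norm and the growth of the orders -/

section Norm

variable {Q : ℕ}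

/-- The sum of the absolute values of the Fourier coefficients. -/
def l1Norm (a : TrigPoly Q) : ℝ := ∑ k ∈ a.coeff.support, ‖a.coeff k‖

lemma l1Norm_eq_sum {a : TrigPoly Q} {t : Finset (quasilattice Q)} (h : a.coeff.support ⊆ t) :
    l1Norm a = ∑ k ∈ t, ‖a.coeff k‖ :=
  Finset.sum_subset h fun k _ hk => by rw [Finsupp.notMem_support_iff.1 hk, norm_zero]

lemma l1Norm_nonneg (a : TrigPoly Q) : 0 ≤ l1Norm a := Finset.sum_nonneg fun _ _ => norm_nonneg _

lemma l1Norm_zero : l1Norm (0 : TrigPoly Q) = 0 := Finset.sum_empty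

lemma l1Norm_add_le (a b : TrigPoly Q) : l1Norm (a + b) ≤ l1Norm a + l1Norm b := by
  classical
  rw [l1Norm_eq_sum (a := a + b) (t := a.coeff.support ∪ b.coeff.support) Finsupp.support_add,
    l1Norm_eq_sum (a := a) Finset.subset_union_left,
    l1Norm_eq_sum (a := b) Finset.subset_union_right, ← Finset.sum_add_distrib]
  exact Finset.sum_le_sum fun k _ => norm_add_le _ _

lemma l1Norm_sum_le {ι : Type*} (t : Finset ι) (f : ι → TrigPoly Q) :
    l1Norm (∑ i ∈ t, f i) ≤ ∑ i ∈ t, l1Norm (f i) :=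
  Finset.le_sum_of_subadditive l1Norm l1Norm_zero.le l1Norm_add_le t f

lemma l1Norm_single (k : quasilattice Q) (c : ℂ) :
    l1Norm (AddMonoidAlgebra.single k c) = ‖c‖ := by
  rw [l1Norm_eq_sum (a := AddMonoidAlgebra.single k c) (t := {k}) Finsupp.support_single_subset, Finset.sum_singleton,
    AddMonoidAlgebra.coeff_single, Finsupp.single_eq_same]

lemma l1Norm_diagOp_le {f : quasilattice Q → ℂ} {a : TrigPoly Q} {M : ℝ}
    (h : ∀ k, a.coeff k ≠ 0 → ‖f k‖ ≤ M) : l1Norm (diagOp f a) ≤ M * l1Norm a := by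
  rw [l1Norm_eq_sum (a := diagOp f a) (t := a.coeff.support) fun k hk =>
    Finsupp.mem_support_iff.2 (right_ne_zero_of_mul (Finsupp.mem_support_iff.1 hk)), l1Norm,
    Finset.mul_sum]
  refine Finset.sum_le_sum fun k hk => ?_
  rw [coeff_diagOp, norm_mul]
  exact mul_le_mul_of_nonneg_right (h k (Finsupp.mem_support_iff.1 hk)) (norm_nonneg _)

lemma l1Norm_smul_le (c : ℂ) (a : TrigPoly Q) : l1Norm (c • a) ≤ ‖c‖ * l1Norm a :=
  l1Norm_diagOp_le (f := fun _ => c) fun _ _ => le_rfl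

lemma l1Norm_sub_smul_le (c : ℂ) (a b : TrigPoly Q) :
    l1Norm (a - c • b) ≤ l1Norm a + ‖c‖ * l1Norm b := by
  rw [sub_eq_add_neg, ← neg_smul, ← norm_neg c]
  exact (l1Norm_add_le _ _).trans (add_le_add_right (l1Norm_smul_le _ _) _)

/-- Submultiplicativity with constant 1 lets the majorant argument run without the algebra constant
of H_s. -/
lemma l1Norm_mul_le (a b : TrigPoly Q) : l1Norm (a * b) ≤ l1Norm a * l1Norm b := by
  have h : l1Norm a * l1Norm b =
      ∑ k ∈ a.coeff.support, ∑ q ∈ b.coeff.support, ‖a.coeff k‖ * ‖b.coeff q‖ :=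
    Finset.sum_mul_sum _ _ _ _
  rw [h, AddMonoidAlgebra.mul_def, Finsupp.sum]
  refine (l1Norm_sum_le _ _).trans (Finset.sum_le_sum fun k _ => ?_)
  rw [Finsupp.sum]
  refine (l1Norm_sum_le _ _).trans (Finset.sum_le_sum fun k _ => ?_)
  rw [l1Norm_single, norm_mul]

lemma norm_coeff_le_l1Norm (a : TrigPoly Q) (k : quasilattice Q) : ‖a.coeff k‖ ≤ l1Norm a := by
  by_cases hk : k ∈ a.coeff.support
  · exact Finset.single_le_sum (f := fun k => ‖a.coeff k‖) (fun _ _ => norm_nonneg _) hk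
  · rw [Finsupp.notMem_support_iff.1 hk, norm_zero]
    exact l1Norm_nonneg a

lemma l1Norm_leadingPoly_le : l1Norm (leadingPoly Q) ≤ Q := by
  refine (l1Norm_sum_le _ _).trans (le_of_eq ?_)
  simp [l1Norm_single]

/-- The Fourier coefficients are supported on points of order at most `d`. -/
def OrderLE (d : ℕ) (a : TrigPoly Q) : Prop := ∀ k, a.coeff k ≠ 0 → order Q k ≤ d

lemma OrderLE.zero (d : ℕ) : OrderLE d (0 : TrigPoly Q) := fun _ h => absurd rfl h

lemma OrderLE.mono {d e : ℕ} {a : TrigPoly Q} (h : OrderLE d a) (hde : d ≤ e) : OrderLE e a :=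
  fun k hk => (h k hk).trans hde

lemma OrderLE.add {d : ℕ} {a b : TrigPoly Q} (ha : OrderLE d a) (hb : OrderLE d b) :
    OrderLE d (a + b) := by
  intro k hk
  by_cases h : a.coeff k = 0
  · exact hb k fun h' => hk (by simp [h, h'])
  · exact ha k h

lemma OrderLE.sum {ι : Type*} {t : Finset ι} {f : ι → TrigPoly Q} {d : ℕ}
    (h : ∀ i ∈ t, OrderLE d (f i)) : OrderLE d (∑ i ∈ t, f i) :=
  Finset.sum_induction f _ (fun _ _ => OrderLE.add) (OrderLE.zero d) h

lemma OrderLE.diagOp {d : ℕ} {a : TrigPoly Q} (ha : OrderLE d a) (f : quasilattice Q → ℂ) :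
    OrderLE d (diagOp f a) := fun k hk => ha k (right_ne_zero_of_mul hk)

lemma OrderLE.smul {d : ℕ} {a : TrigPoly Q} (ha : OrderLE d a) (c : ℂ) : OrderLE d (c • a) :=
  ha.diagOp fun _ => c

lemma OrderLE.mul {d e : ℕ} {a b : TrigPoly Q} (ha : OrderLE d a) (hb : OrderLE e b) :
    OrderLE (d + e) (a * b) := by
  classical
  intro k hk
  rw [AddMonoidAlgebra.coeff_mul, Finsupp.sum] at hk
  obtain ⟨p, hp, hk⟩ := Finset.exists_ne_zero_of_sum_ne_zero hk
  obtain ⟨q, hq, hk⟩ := Finset.exists_ne_zero_of_sum_ne_zero hk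
  have hpq : p + q = k := by
    by_contra h
    exact hk (if_neg h)
  rw [← hpq]
  exact (order_add_le p q).trans (add_le_add (ha p (Finsupp.mem_support_iff.1 hp))
    (hb q (Finsupp.mem_support_iff.1 hq)))

lemma orderLE_leadingPoly : OrderLE 1 (leadingPoly Q) := by
  classical
  refine OrderLE.sum fun j _ k hk => ?_
  rw [AddMonoidAlgebra.coeff_single, Finsupp.single_apply] at hk
  have h : wave j = k := by
    by_contra h
    exact hk (if_neg h)
  exact h ▸ order_wave_le j

/-- Each weight on the support is at most its value at order d, and the ℓ² norm is at most the ℓ¹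
norm. -/
lemma hNorm_toFourier_le {s : ℝ} (hs : 0 ≤ s) {d : ℕ} {a : TrigPoly Q} (ha : OrderLE d a) :
    hNorm Q s (toFourier a) ≤ (1 + (d : ℝ) ^ 2) ^ (s / 2) * l1Norm a := by
  have hd : (0 : ℝ) ≤ 1 + (d : ℝ) ^ 2 := by positivity
  refine Real.sqrt_le_iff.2 ⟨mul_nonneg (by positivity) (l1Norm_nonneg a), ?_⟩
  rw [tsum_eq_sum (s := a.coeff.support) fun k hk => by
    rw [toFourier_apply, Finsupp.notMem_support_iff.1 hk]; simp, mul_pow, ← Real.rpow_mul_natCast hd,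
    Nat.cast_ofNat, div_mul_cancel₀ s two_ne_zero]
  calc ∑ k ∈ a.coeff.support, weight Q s k * ‖toFourier a k‖ ^ 2
      ≤ ∑ k ∈ a.coeff.support, (1 + (d : ℝ) ^ 2) ^ s * ‖a.coeff k‖ ^ 2 := by
        refine Finset.sum_le_sum fun k hk => mul_le_mul_of_nonneg_right ?_ (sq_nonneg _)
        have : (order Q k : ℝ) ≤ d := mod_cast ha k (Finsupp.mem_support_iff.1 hk)
        exact Real.rpow_le_rpow (by positivity) (by gcongr) hs
    _ ≤ (1 + (d : ℝ) ^ 2) ^ s * l1Norm a ^ 2 := by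
        rw [← Finset.mul_sum]
        exact mul_le_mul_of_nonneg_left
          (Finset.sum_sq_le_sq_sum_of_nonneg fun k _ => norm_nonneg _) (by positivity)

lemma l1Norm_opLInv_le (hQ : 2 < Q) {d : ℕ} {a : TrigPoly Q} (ha : OrderLE d a) :
    l1Norm (opLInv a) ≤ (1 + (d : ℝ) ^ 2) ^ (Q.totient - 2) * l1Norm a := by
  refine l1Norm_diagOp_le fun k hk => ?_
  have h0 : 0 ≤ symbol k := sq_nonneg _
  rw [norm_inv, Complex.norm_real, Real.norm_of_nonneg h0]
  exact inv_symbol_le hQ (ha k hk)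

lemma orderLE_coeff_mul {c e : ℕ} {u v : (TrigPoly Q)⟦X⟧} (hu : ∀ n, OrderLE (2 * n + c) (coeff n u))
    (hv : ∀ n, OrderLE (2 * n + e) (coeff n v)) (n : ℕ) :
    OrderLE (2 * n + (c + e)) (coeff n (u * v)) := by
  rw [coeff_mul]
  refine OrderLE.sum fun p hp => ((hu p.1).mul (hv p.2)).mono ?_
  have := Finset.HasAntidiagonal.mem_antidiagonal.1 hp
  omega

lemma orderLE_coeff_cube {u : (TrigPoly Q)⟦X⟧} (hu : ∀ n, OrderLE (2 * n + 1) (coeff n u)) (n : ℕ) :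
    OrderLE (2 * n + 3) (coeff n (u ^ 3)) := by
  rw [pow_three']
  exact orderLE_coeff_mul (orderLE_coeff_mul hu hu) hu n

/-- Since 2n + 3 = 2(n + 1) + 1, the degree bound reproduces itself along the recursion. -/
lemma orderLE_nextW_arg {u : (TrigPoly Q)⟦X⟧} (hu : ∀ n, OrderLE (2 * n + 1) (coeff n u)) (n : ℕ) :
    OrderLE (2 * n + 3) (coeff n u - (beta Q : ℂ)⁻¹ • coeff n (u ^ 3)) := by
  rw [sub_eq_add_neg, ← neg_smul]
  exact ((hu n).mono (by omega)).add ((orderLE_coeff_cube hu n).smul _)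

lemma orderLE_coeff_truncSol [NeZero Q] (n i : ℕ) :
    OrderLE (2 * i + 1) (coeff i (truncSol Q n)) := by
  induction n generalizing i with
  | zero =>
    rw [truncSol, coeff_C]
    split_ifs
    · exact orderLE_leadingPoly.mono (by omega)
    · exact OrderLE.zero _
  | succ n ih =>
    rw [truncSol, map_add, coeff_monomial]
    refine (ih i).add ?_
    split_ifs with h
    · subst h
      exact ((orderLE_leadingPoly.smul _).mono (by omega)).add ((orderLE_nextW_arg ih n).diagOp _)
    · exact OrderLE.zero _

lemma orderLE_coeff_solU [NeZero Q] (n : ℕ) : OrderLE (2 * n + 1) (coeff n (solU Q)) := by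
  rw [← coeff_truncSol_of_le le_rfl]
  exact orderLE_coeff_truncSol n n

lemma orderLE_solW [NeZero Q] (n : ℕ) : OrderLE (2 * n + 1) (solW Q n) := by
  cases n with
  | zero => exact OrderLE.zero _
  | succ n => exact (orderLE_nextW_arg (orderLE_coeff_truncSol n) n).diagOp _

end Norm

/-! ### Majorant series -/

section Majorant

variable {Q : ℕ}

/-- The series `x` dominates `u` with a loss of `n ! ^ σ`. -/
def Dominated (σ : ℕ) (u : (TrigPoly Q)⟦X⟧) (x : ℝ⟦X⟧) : Prop :=
  ∀ n, l1Norm (coeff n u) ≤ (n.factorial : ℝ) ^ σ * coeff n x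

lemma Dominated.coeff_nonneg {σ : ℕ} {u : (TrigPoly Q)⟦X⟧} {x : ℝ⟦X⟧} (h : Dominated σ u x) (n : ℕ) :
    0 ≤ coeff n x := by
  have h1 := (l1Norm_nonneg _).trans (h n)
  have h2 : (0 : ℝ) < (n.factorial : ℝ) ^ σ := by positivity
  exact nonneg_of_mul_nonneg_right h1 h2

/-- Because p! q! ≤ (p + q)!, products do not increase the factorial loss. -/
lemma Dominated.mul {σ : ℕ} {u v : (TrigPoly Q)⟦X⟧} {x y : ℝ⟦X⟧} (hu : Dominated σ u x)
    (hv : Dominated σ v y) : Dominated σ (u * v) (x * y) := by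
  intro n
  rw [coeff_mul, coeff_mul, Finset.mul_sum]
  refine (l1Norm_sum_le _ _).trans (Finset.sum_le_sum fun p hp => ?_)
  refine (l1Norm_mul_le _ _).trans ?_
  have hxp := hu.coeff_nonneg p.1
  have hyp := hv.coeff_nonneg p.2
  have hfac : (p.1.factorial : ℝ) * p.2.factorial ≤ n.factorial := by
    rw [← Finset.HasAntidiagonal.mem_antidiagonal.1 hp]
    exact_mod_cast Nat.le_of_dvd (Nat.factorial_pos _)
      (Nat.factorial_mul_factorial_dvd_factorial_add p.1 p.2)
  calc l1Norm (coeff p.1 u) * l1Norm (coeff p.2 v)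
      ≤ ((p.1.factorial : ℝ) ^ σ * coeff p.1 x) * ((p.2.factorial : ℝ) ^ σ * coeff p.2 y) :=
        mul_le_mul (hu _) (hv _) (l1Norm_nonneg _) (by positivity)
    _ = ((p.1.factorial : ℝ) * p.2.factorial) ^ σ * (coeff p.1 x * coeff p.2 y) := by
        rw [mul_pow]; ring
    _ ≤ (n.factorial : ℝ) ^ σ * (coeff p.1 x * coeff p.2 y) := by gcongr

lemma Dominated.cube {σ : ℕ} {u : (TrigPoly Q)⟦X⟧} {x : ℝ⟦X⟧} (hu : Dominated σ u x) :
    Dominated σ (u ^ 3) (x ^ 3) := by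
  rw [pow_three', pow_three']
  exact (hu.mul hu).mul hu

lemma coeff_mul_le_coeff_mul {x x' y y' : ℝ⟦X⟧} (hx : ∀ n, 0 ≤ coeff n x)
    (hxx : ∀ n, coeff n x ≤ coeff n x') (hy : ∀ n, 0 ≤ coeff n y)
    (hyy : ∀ n, coeff n y ≤ coeff n y') (n : ℕ) :
    0 ≤ coeff n (x * y) ∧ coeff n (x * y) ≤ coeff n (x' * y') := by
  rw [coeff_mul, coeff_mul]
  exact ⟨Finset.sum_nonneg fun p _ => mul_nonneg (hx _) (hy _), Finset.sum_le_sum fun p _ =>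
    mul_le_mul (hxx _) (hyy _) (hy _) ((hx _).trans (hxx _))⟩

lemma coeff_cube_le_coeff_cube {x x' : ℝ⟦X⟧} (hx : ∀ n, 0 ≤ coeff n x)
    (hxx : ∀ n, coeff n x ≤ coeff n x') (n : ℕ) : coeff n (x ^ 3) ≤ coeff n (x' ^ 3) := by
  rw [pow_three', pow_three']
  have h := coeff_mul_le_coeff_mul hx hxx hx hxx
  exact (coeff_mul_le_coeff_mul (fun n => (h n).1) (fun n => (h n).2) hx hxx n).2

lemma sum_inv_sq_le (n : ℕ) :
    ∑ i ∈ Finset.range (n + 1), (((i : ℝ) + 1) ^ 2)⁻¹ ≤ 2 - ((n : ℝ) + 1)⁻¹ := by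
  induction n with
  | zero => norm_num
  | succ n ih =>
    rw [Finset.sum_range_succ]
    have h1 : (((n : ℝ) + 1 + 1) ^ 2)⁻¹ ≤ ((n : ℝ) + 1)⁻¹ - ((n : ℝ) + 1 + 1)⁻¹ := by
      have : (0 : ℝ) < n + 1 := by positivity
      rw [inv_sub_inv (by positivity) (by positivity), inv_eq_one_div,
        div_le_div_iff₀ (by positivity) (by positivity)]
      nlinarith
    push_cast
    linarith

/-- For p + q = n one has (n + 1)² ≤ 2 ((p + 1)² + (q + 1)²), which splits each term into two
inverse squares; either resulting sum is at most 2. -/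
lemma sum_antidiagonal_inv_sq_le (n : ℕ) :
    ∑ p ∈ Finset.HasAntidiagonal.antidiagonal n,
      (((p.1 : ℝ) + 1) ^ 2)⁻¹ * (((p.2 : ℝ) + 1) ^ 2)⁻¹ ≤ 8 * (((n : ℝ) + 1) ^ 2)⁻¹ := by
  have hpt : ∀ p ∈ Finset.HasAntidiagonal.antidiagonal n,
      (((p.1 : ℝ) + 1) ^ 2)⁻¹ * (((p.2 : ℝ) + 1) ^ 2)⁻¹ ≤
        2 * (((n : ℝ) + 1) ^ 2)⁻¹ * ((((p.1 : ℝ) + 1) ^ 2)⁻¹ + (((p.2 : ℝ) + 1) ^ 2)⁻¹) := by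
    intro p hp
    have hn : (n : ℝ) = p.1 + p.2 := by
      rw [← Finset.HasAntidiagonal.mem_antidiagonal.1 hp]; push_cast; ring
    have h1 : (0 : ℝ) < (p.1 : ℝ) + 1 := by positivity
    have h2 : (0 : ℝ) < (p.2 : ℝ) + 1 := by positivity
    rw [hn]
    have h3 : (0 : ℝ) < (p.1 : ℝ) + p.2 + 1 := by positivity
    have h4 : (0 : ℝ) ≤ p.1 := by positivity
    have h5 : (0 : ℝ) ≤ p.2 := by positivity
    have h6 : 2 * (((p.1 : ℝ) + p.2 + 1) ^ 2)⁻¹ * ((((p.1 : ℝ) + 1) ^ 2)⁻¹ + (((p.2 : ℝ) + 1) ^ 2)⁻¹) =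
        (2 * (((p.1 : ℝ) + 1) ^ 2 + ((p.2 : ℝ) + 1) ^ 2) / ((p.1 : ℝ) + p.2 + 1) ^ 2) *
          ((((p.1 : ℝ) + 1) ^ 2)⁻¹ * (((p.2 : ℝ) + 1) ^ 2)⁻¹) := by
      field_simp
      ring
    rw [h6]
    refine le_mul_of_one_le_left (by positivity) ((one_le_div (by positivity)).2 ?_)
    nlinarith [sq_nonneg ((p.1 : ℝ) - p.2)]
  refine (Finset.sum_le_sum hpt).trans ?_
  rw [← Finset.mul_sum, Finset.sum_add_distrib,
    Finset.Nat.sum_antidiagonal_eq_sum_range_succ_mk, Finset.Nat.sum_antidiagonal_eq_sum_range_succ_mk]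
  have h2 : ∑ k ∈ Finset.range n.succ, ((((n - k : ℕ) : ℝ) + 1) ^ 2)⁻¹ =
      ∑ k ∈ Finset.range (n + 1), (((k : ℝ) + 1) ^ 2)⁻¹ := by
    rw [← Finset.sum_range_reflect (fun k : ℕ => (((k : ℝ) + 1) ^ 2)⁻¹)]
    rfl
  have h3 := sum_inv_sq_le n
  have h4 : (0 : ℝ) ≤ ((n : ℝ) + 1)⁻¹ := by positivity
  have h5 : (0 : ℝ) ≤ (((n : ℝ) + 1) ^ 2)⁻¹ := by positivity
  simp only [h2]
  rw [show 8 * (((n : ℝ) + 1) ^ 2)⁻¹ = 2 * (((n : ℝ) + 1) ^ 2)⁻¹ * (2 + 2) by ring]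
  refine mul_le_mul_of_nonneg_left (add_le_add ?_ ?_) (by positivity)
  · exact h3.trans (by linarith)
  · exact h3.trans (by linarith)

/-- The series `∑ n, K ^ n / (n + 1) ^ 2 * X ^ n`, stable under products up to a factor. -/
def geomSeries (K : ℝ) : ℝ⟦X⟧ := mk fun n => K ^ n * (((n : ℝ) + 1) ^ 2)⁻¹

lemma coeff_geomSeries (K : ℝ) (n : ℕ) :
    coeff n (geomSeries K) = K ^ n * (((n : ℝ) + 1) ^ 2)⁻¹ := coeff_mk _ _

lemma coeff_geomSeries_pos {K : ℝ} (hK : 0 < K) (n : ℕ) : 0 < coeff n (geomSeries K) := by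
  rw [coeff_geomSeries]; positivity

lemma coeff_geomSeries_sq_le {K : ℝ} (hK : 0 < K) (n : ℕ) :
    coeff n (geomSeries K * geomSeries K) ≤ 8 * coeff n (geomSeries K) := by
  rw [coeff_mul, coeff_geomSeries]
  have : ∀ p ∈ Finset.HasAntidiagonal.antidiagonal n,
      coeff p.1 (geomSeries K) * coeff p.2 (geomSeries K) =
        K ^ n * ((((p.1 : ℝ) + 1) ^ 2)⁻¹ * (((p.2 : ℝ) + 1) ^ 2)⁻¹) := by
    intro p hp
    rw [coeff_geomSeries, coeff_geomSeries, ← Finset.HasAntidiagonal.mem_antidiagonal.1 hp, pow_add]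
    ring
  rw [Finset.sum_congr rfl this, ← Finset.mul_sum, mul_left_comm]
  exact mul_le_mul_of_nonneg_left (sum_antidiagonal_inv_sq_le n) (by positivity)

lemma coeff_geomSeries_cube_le {K : ℝ} (hK : 0 < K) (n : ℕ) :
    coeff n (geomSeries K ^ 3) ≤ 64 * coeff n (geomSeries K) := by
  have h0 := fun n => (coeff_geomSeries_pos hK n).le
  have h8 : ∀ x : ℝ⟦X⟧, ∀ n, coeff n (C (8 : ℝ) * x) = 8 * coeff n x := fun x n => coeff_C_mul _ _ _
  have h1 := (coeff_mul_le_coeff_mul (x := geomSeries K * geomSeries K)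
    (x' := C (8 : ℝ) * geomSeries K) (fun n => (coeff_mul_le_coeff_mul h0 (fun _ => le_rfl) h0
      (fun _ => le_rfl) n).1) (fun n => by rw [h8]; exact coeff_geomSeries_sq_le hK n) h0
      (fun _ => le_rfl) n).2
  rw [pow_three']
  refine h1.trans ?_
  rw [mul_assoc, h8]
  linarith [coeff_geomSeries_sq_le hK n]

/-- The majorant series: `q` at order zero and a small multiple of a geometric-type series beyond. -/
def majorant (q δ K : ℝ) : ℝ⟦X⟧ := mk fun n => if n = 0 then q else δ * coeff n (geomSeries K)

/-- The truncation at order `n` of the majorant series. -/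
def truncMajorant (q δ K : ℝ) (n : ℕ) : ℝ⟦X⟧ :=
  mk fun i => if i ≤ n then coeff i (majorant q δ K) else 0

lemma coeff_majorant_le {q δ K : ℝ} (hq : 0 ≤ q) (hδ : δ ≤ 1) (hK : 0 < K) (n : ℕ) :
    coeff n (majorant q δ K) ≤ (q + 1) * coeff n (geomSeries K) := by
  have h0 := coeff_geomSeries_pos hK n
  rw [majorant, coeff_mk]
  split_ifs with h
  · subst h
    rw [coeff_geomSeries]
    norm_num
  · exact mul_le_mul_of_nonneg_right (by linarith) h0.le

lemma coeff_majorant_nonneg {q δ K : ℝ} (hq : 0 ≤ q) (hδ : 0 ≤ δ) (hK : 0 < K) (n : ℕ) :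
    0 ≤ coeff n (majorant q δ K) := by
  rw [majorant, coeff_mk]
  split_ifs
  · exact hq
  · exact mul_nonneg hδ (coeff_geomSeries_pos hK n).le

lemma coeff_majorant_cube_le {q δ K : ℝ} (hq : 0 ≤ q) (hδ : 0 ≤ δ) (hδ1 : δ ≤ 1) (hK : 0 < K)
    (n : ℕ) : coeff n (majorant q δ K ^ 3) ≤ 64 * (q + 1) ^ 3 * coeff n (geomSeries K) := by
  refine (coeff_cube_le_coeff_cube (x' := C (q + 1) * geomSeries K)
    (coeff_majorant_nonneg hq hδ hK) (fun n => ?_) n).trans ?_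
  · rw [coeff_C_mul]
    exact coeff_majorant_le hq hδ1 hK n
  · rw [mul_pow, ← map_pow, coeff_C_mul, mul_comm (64 : ℝ), mul_assoc]
    exact mul_le_mul_of_nonneg_left (coeff_geomSeries_cube_le hK n) (by positivity)

/-- Expand (q + δ g)³: the term linear in δ drops out because the truncated g vanishes at n + 1. The
remaining 3qδ² · 8 + δ³ · 64 is quadratic in δ, hence absorbable when δ is small. -/
lemma coeff_truncMajorant_cube_succ_le {q δ K : ℝ} (hq : 0 ≤ q) (hδ : 0 ≤ δ) (hδ1 : δ ≤ 1)
    (hK : 0 < K) (n : ℕ) : coeff (n + 1) (truncMajorant q δ K n ^ 3) ≤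
      (24 * q + 64) * δ ^ 2 * coeff (n + 1) (geomSeries K) := by
  let g : ℝ⟦X⟧ := mk fun i => if i = 0 then 0 else if i ≤ n then coeff i (geomSeries K) else 0
  have hg0 : ∀ i, 0 ≤ coeff i g := fun i => by
    rw [coeff_mk]
    split_ifs
    exacts [le_rfl, (coeff_geomSeries_pos hK i).le, le_rfl]
  have hg1 : ∀ i, coeff i g ≤ coeff i (geomSeries K) := fun i => by
    rw [coeff_mk]
    have := (coeff_geomSeries_pos hK i).le
    split_ifs
    exacts [this, le_rfl, this]
  have ht : truncMajorant q δ K n = C q + C δ * g := by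
    ext i
    rw [truncMajorant, coeff_mk, majorant, coeff_mk, map_add, coeff_C_mul, coeff_C, coeff_mk]
    by_cases h : i = 0
    · subst h; simp
    · by_cases h' : i ≤ n <;> simp [h, h']
  have hexp : truncMajorant q δ K n ^ 3 = C (q ^ 3) + C (3 * q ^ 2 * δ) * g +
      C (3 * q * δ ^ 2) * (g * g) + C (δ ^ 3) * g ^ 3 := by
    rw [ht]
    simp only [map_mul, map_pow, map_ofNat]
    ring
  have hgn : coeff (n + 1) g = 0 := by
    rw [coeff_mk, if_neg (by omega), if_neg (by omega)]
  have h2 := ((coeff_mul_le_coeff_mul hg0 hg1 hg0 hg1 (n + 1)).2).trans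
    (coeff_geomSeries_sq_le hK (n + 1))
  have h3 := (coeff_cube_le_coeff_cube hg0 hg1 (n + 1)).trans (coeff_geomSeries_cube_le hK (n + 1))
  have hpos := (coeff_geomSeries_pos hK (n + 1)).le
  rw [hexp, map_add, map_add, map_add, coeff_C_mul, coeff_C_mul, coeff_C_mul, coeff_C,
    if_neg (by omega), hgn]
  have e2 := mul_le_mul_of_nonneg_left h2 (show 0 ≤ 3 * q * δ ^ 2 by positivity)
  have e3 := mul_le_mul_of_nonneg_left h3 (show 0 ≤ δ ^ 3 by positivity)
  have e4 : δ ^ 3 ≤ δ ^ 2 := pow_le_pow_of_le_one hδ hδ1 (by norm_num)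
  have e5 := mul_le_mul_of_nonneg_right e4 (show 0 ≤ 64 * coeff (n + 1) (geomSeries K) by positivity)
  linarith

lemma coeff_geomSeries_le_succ {K : ℝ} (hK : 0 < K) (n : ℕ) :
    coeff n (geomSeries K) ≤ 4 / K * coeff (n + 1) (geomSeries K) := by
  rw [coeff_geomSeries, coeff_geomSeries, pow_succ K n]
  have h : (((n : ℝ) + 1) ^ 2)⁻¹ ≤ 4 * ((((n + 1 : ℕ) : ℝ) + 1) ^ 2)⁻¹ := by
    have : (0 : ℝ) ≤ n := by positivity
    push_cast
    rw [← div_eq_mul_inv, inv_eq_one_div, div_le_div_iff₀ (by positivity) (by positivity)]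
    nlinarith
  rw [show 4 / K * (K ^ n * K * ((((n + 1 : ℕ) : ℝ) + 1) ^ 2)⁻¹) =
    K ^ n * (4 * ((((n + 1 : ℕ) : ℝ) + 1) ^ 2)⁻¹) by field_simp]
  exact mul_le_mul_of_nonneg_left h (by positivity)

/-- Existence of a majorant series that is stable under the recursion. -/
lemma exists_majorant {c q : ℝ} (hc : 0 ≤ c) (hq : 0 ≤ q) : ∃ δ K : ℝ, 0 < δ ∧ δ ≤ 1 ∧ 1 ≤ K ∧
    ∀ n, c * (coeff n (majorant q δ K) + coeff n (majorant q δ K ^ 3) +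
      coeff (n + 1) (truncMajorant q δ K n ^ 3)) ≤ coeff (n + 1) (majorant q δ K) := by
  -- With this δ the truncated cube uses half of the budget δ/(c + 1). The constant K below makes
  -- the order-n terms, damped by 4/K, use the other half.
  set δ : ℝ := (2 * (c + 1) * (24 * q + 64))⁻¹ with hδ
  have hδ0 : 0 < δ := by positivity
  have hδ1 : δ ≤ 1 := inv_le_one_of_one_le₀ (by nlinarith)
  set K : ℝ := 8 * (c + 1) * (q + 1 + 64 * (q + 1) ^ 3) / δ with hK
  have hK1 : 1 ≤ K := by
    rw [hK, one_le_div hδ0]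
    refine hδ1.trans ?_
    have : 0 ≤ 64 * (q + 1) ^ 3 := by positivity
    nlinarith
  have hK0 : 0 < K := by linarith
  refine ⟨δ, K, hδ0, hδ1, hK1, fun n => ?_⟩
  have hpos := (coeff_geomSeries_pos hK0 (n + 1)).le
  have h1 := coeff_majorant_le hq hδ1 hK0 n
  have h2 := coeff_majorant_cube_le hq hδ0.le hδ1 hK0 n
  have h3 := coeff_truncMajorant_cube_succ_le hq hδ0.le hδ1 hK0 n
  have h4 := coeff_geomSeries_le_succ hK0 n
  have e : coeff (n + 1) (majorant q δ K) = δ * coeff (n + 1) (geomSeries K) := by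
    rw [majorant, coeff_mk, if_neg (by omega)]
  rw [e]
  set h := coeff (n + 1) (geomSeries K)
  have h5 : (q + 1 + 64 * (q + 1) ^ 3) * coeff n (geomSeries K) ≤ δ / (2 * (c + 1)) * h := by
    refine (mul_le_mul_of_nonneg_left h4 (by positivity)).trans (le_of_eq ?_)
    rw [hK]
    field_simp
    ring
  have h6 : (24 * q + 64) * δ ^ 2 * h = δ / (2 * (c + 1)) * h := by
    rw [sq, ← mul_assoc]
    nth_rewrite 1 [hδ]
    field_simp
  have h7 : coeff n (majorant q δ K) + coeff n (majorant q δ K ^ 3) +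
      coeff (n + 1) (truncMajorant q δ K n ^ 3) ≤ δ / (c + 1) * h := by
    have : δ / (c + 1) * h = δ / (2 * (c + 1)) * h + δ / (2 * (c + 1)) * h := by
      field_simp
      ring
    linarith
  refine (mul_le_mul_of_nonneg_left h7 hc).trans ?_
  rw [← mul_assoc]
  refine mul_le_mul_of_nonneg_right ?_ hpos
  rw [mul_div_assoc', div_le_iff₀ (by positivity)]
  nlinarith

end Majorant

/-! ### Gevrey estimates -/

section Gevrey

variable {Q : ℕ}

lemma four_mul_ell (hQ : 2 < Q) : 4 * ell Q = 2 * (Q.totient - 2) := by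
  obtain ⟨r, hr⟩ := Nat.totient_even hQ
  rw [ell]
  omega

/-- The small divisor loss is exactly one factorial step: 1 + (2n + 3)² ≤ 10 (n + 1)², and raising
this to the power φ(Q) - 2 gives (n + 1)^(4l), which turns n! into (n + 1)!. -/
lemma l1Norm_nextW_le [NeZero Q] (hQ : 2 < Q) (n : ℕ) {x : ℝ⟦X⟧}
    (hS : Dominated (4 * ell Q) (truncSol Q n) x) :
    l1Norm (solW Q (n + 1)) ≤ ((n + 1).factorial : ℝ) ^ (4 * ell Q) *
      (10 ^ (Q.totient - 2) * (coeff n x + coeff n (x ^ 3))) := by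
  have h1 := l1Norm_opLInv_le hQ (orderLE_nextW_arg (orderLE_coeff_truncSol (Q := Q) n) n)
  refine h1.trans ?_
  have hβ : (1 : ℝ) ≤ beta Q := by
    have : (2 : ℝ) < Q := mod_cast hQ
    rw [beta]; linarith
  have h2 : ‖(beta Q : ℂ)⁻¹‖ ≤ 1 := by
    rw [norm_inv, Complex.norm_real, Real.norm_of_nonneg (by linarith)]
    exact inv_le_one_of_one_le₀ hβ
  have h3 : l1Norm (coeff n (truncSol Q n) - (beta Q : ℂ)⁻¹ • coeff n (truncSol Q n ^ 3)) ≤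
      (n.factorial : ℝ) ^ (4 * ell Q) * (coeff n x + coeff n (x ^ 3)) := by
    refine (l1Norm_sub_smul_le _ _ _).trans ?_
    rw [mul_add]
    exact add_le_add (hS n)
      ((mul_le_of_le_one_left (l1Norm_nonneg _) h2).trans (hS.cube n))
  have h4 : (1 + ((2 * n + 3 : ℕ) : ℝ) ^ 2) ^ (Q.totient - 2) ≤
      10 ^ (Q.totient - 2) * ((n : ℝ) + 1) ^ (4 * ell Q) := by
    rw [four_mul_ell hQ, pow_mul, ← mul_pow]
    refine pow_le_pow_left₀ (by positivity) ?_ _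
    push_cast
    nlinarith [(Nat.cast_nonneg n : (0 : ℝ) ≤ n)]
  refine (mul_le_mul h4 h3 (l1Norm_nonneg _) (by positivity)).trans (le_of_eq ?_)
  rw [Nat.factorial_succ]
  push_cast
  rw [mul_pow]
  ring

lemma norm_nextB_le [NeZero Q] (hQ : 2 < Q) (n : ℕ) :
    ‖solB Q (n + 1)‖ ≤ l1Norm (coeff (n + 1) (truncSol Q n ^ 3)) +
      3 * (Q : ℝ) ^ 2 * l1Norm (solW Q (n + 1)) := by
  have hβ : (1 : ℝ) ≤ beta Q := by
    have : (2 : ℝ) < Q := mod_cast hQ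
    rw [beta]; linarith
  have h2 : ‖-(2 * (beta Q : ℂ))⁻¹‖ ≤ 1 := by
    rw [norm_neg, norm_inv, norm_mul, Complex.norm_real, Real.norm_of_nonneg (by linarith),
      Complex.norm_ofNat]
    exact inv_le_one_of_one_le₀ (by linarith)
  rw [solB, nextB, norm_mul]
  refine (mul_le_of_le_one_left (norm_nonneg _) h2).trans ?_
  refine (norm_coeff_le_l1Norm _ _).trans ((l1Norm_add_le _ _).trans (add_le_add_right ?_ _))
  have h3 : (3 : TrigPoly Q) * leadingPoly Q ^ 2 * nextW (truncSol Q n) n =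
      (3 : ℂ) • (leadingPoly Q * leadingPoly Q * nextW (truncSol Q n) n) := by
    rw [Algebra.smul_def, map_ofNat]; ring
  rw [h3]
  refine (l1Norm_smul_le _ _).trans ?_
  rw [Complex.norm_ofNat, mul_assoc (3 : ℝ)]
  refine mul_le_mul_of_nonneg_left ?_ (by norm_num)
  refine (l1Norm_mul_le _ _).trans (mul_le_mul_of_nonneg_right ?_ (l1Norm_nonneg _))
  rw [sq]
  exact (l1Norm_mul_le _ _).trans (mul_le_mul l1Norm_leadingPoly_le l1Norm_leadingPoly_le
    (l1Norm_nonneg _) (by positivity))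

lemma l1Norm_coeff_solU_le [NeZero Q] (n : ℕ) :
    l1Norm (coeff n (solU Q)) ≤ Q * ‖solB Q n‖ + l1Norm (solW Q n) := by
  rw [coeff_solU, mul_comm]
  exact (l1Norm_add_le _ _).trans (add_le_add_left ((l1Norm_smul_le _ _).trans
    (mul_le_mul_of_nonneg_left l1Norm_leadingPoly_le (norm_nonneg _))) _)

/-- Gevrey estimates for the sums of the absolute values of the Fourier coefficients. -/
lemma exists_l1Norm_le [NeZero Q] (hQ : 2 < Q) : ∃ A K : ℝ, 0 < A ∧ 1 ≤ K ∧ ∀ n,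
    l1Norm (solW Q n) ≤ A * K ^ n * (n.factorial : ℝ) ^ (4 * ell Q) ∧
    ‖solB Q n‖ ≤ A * K ^ n * (n.factorial : ℝ) ^ (4 * ell Q) ∧
    l1Norm (coeff n (solU Q)) ≤ A * K ^ n * (n.factorial : ℝ) ^ (4 * ell Q) := by
  set σ := 4 * ell Q
  set D : ℝ := 10 ^ (Q.totient - 2)
  have hD : 0 < D := by positivity
  have hq : (0 : ℝ) ≤ Q := Nat.cast_nonneg Q
  have hq1 : (1 : ℝ) ≤ Q := mod_cast NeZero.pos Q
  -- This constant dominates both coefficients in the bound Q t + (3Q³D + D) a for the whole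
  -- coefficient in `hU` below.
  obtain ⟨δ, K, hδ, hδ1, hK, hmaj⟩ := exists_majorant (c := 3 * (Q : ℝ) ^ 3 * D + D + Q) (q := Q)
    (by positivity) hq
  have hK0 : 0 < K := by linarith
  have hx0 := coeff_majorant_nonneg hq hδ.le hK0
  have step : ∀ n, Dominated σ (truncSol Q n) (truncMajorant Q δ K n) →
      l1Norm (solW Q (n + 1)) ≤ ((n + 1).factorial : ℝ) ^ σ * coeff (n + 1) (majorant Q δ K) ∧
      ‖solB Q (n + 1)‖ ≤ ((n + 1).factorial : ℝ) ^ σ * coeff (n + 1) (majorant Q δ K) ∧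
      l1Norm (coeff (n + 1) (solU Q)) ≤
        ((n + 1).factorial : ℝ) ^ σ * coeff (n + 1) (majorant Q δ K) := by
    intro n hS
    set F : ℝ := ((n + 1).factorial : ℝ) ^ σ with hF
    have hF0 : 0 < F := by positivity
    have ht0 := hS.coeff_nonneg
    have hle : ∀ i, coeff i (truncMajorant Q δ K n) ≤ coeff i (majorant Q δ K) := fun i => by
      rw [truncMajorant, coeff_mk]
      split_ifs
      exacts [le_rfl, hx0 i]
    have hW := l1Norm_nextW_le hQ n hS
    set a := coeff n (majorant Q δ K) + coeff n (majorant Q δ K ^ 3) with ha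
    set t := coeff (n + 1) (truncMajorant Q δ K n ^ 3) with ht
    have ht1 : 0 ≤ t := hS.cube.coeff_nonneg _
    have hW' : l1Norm (solW Q (n + 1)) ≤ F * (D * a) := hW.trans (by
      have := add_le_add (hle n) (coeff_cube_le_coeff_cube ht0 hle n)
      gcongr)
    have ha0 : 0 ≤ a := nonneg_of_mul_nonneg_right
      (nonneg_of_mul_nonneg_right ((l1Norm_nonneg _).trans hW') hF0) hD
    have hB : ‖solB Q (n + 1)‖ ≤ F * (t + 3 * (Q : ℝ) ^ 2 * (D * a)) := by
      refine (norm_nextB_le hQ n).trans ?_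
      rw [mul_add]
      refine add_le_add (hS.cube _) ?_
      refine (mul_le_mul_of_nonneg_left hW' (by positivity)).trans (le_of_eq (by ring))
    have hU : l1Norm (coeff (n + 1) (solU Q)) ≤
        F * (Q * (t + 3 * (Q : ℝ) ^ 2 * (D * a)) + D * a) := by
      refine (l1Norm_coeff_solU_le _).trans ?_
      rw [mul_add]
      refine add_le_add ((mul_le_mul_of_nonneg_left hB hq).trans (le_of_eq (by ring))) hW'
    have hx := hmaj n
    have hDa : 0 ≤ D * a := by positivity
    have hlast : Q * (t + 3 * (Q : ℝ) ^ 2 * (D * a)) + D * a ≤ coeff (n + 1) (majorant Q δ K) := by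
      refine le_trans ?_ hx
      have : 0 ≤ 3 * (Q : ℝ) ^ 3 * D * t + D * t + Q * a := by positivity
      nlinarith
    have hs : 0 ≤ t + 3 * (Q : ℝ) ^ 2 * (D * a) := by positivity
    have hmid : t + 3 * (Q : ℝ) ^ 2 * (D * a) ≤ Q * (t + 3 * (Q : ℝ) ^ 2 * (D * a)) :=
      le_mul_of_one_le_left hs hq1
    exact ⟨hW'.trans (mul_le_mul_of_nonneg_left (by linarith) hF0.le),
      hB.trans (mul_le_mul_of_nonneg_left (by linarith) hF0.le),
      hU.trans (mul_le_mul_of_nonneg_left hlast hF0.le)⟩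
  have hzero : l1Norm (coeff 0 (solU Q)) ≤ Q := by
    rw [coeff_zero_solU]
    exact l1Norm_leadingPoly_le
  have hdom : ∀ n, Dominated σ (truncSol Q n) (truncMajorant Q δ K n) := by
    have main : ∀ n, l1Norm (coeff n (solU Q)) ≤
        (n.factorial : ℝ) ^ σ * coeff n (majorant Q δ K) := by
      intro n
      induction n using Nat.strong_induction_on with
      | _ n ih =>
      cases n with
      | zero => simpa [majorant] using hzero
      | succ n =>
        refine (step n fun i => ?_).2.2
        rw [coeff_truncSol, truncMajorant, coeff_mk]
        split_ifs with h
        · exact ih i (by omega)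
        · rw [l1Norm_zero, mul_zero]
    intro n i
    rw [coeff_truncSol, truncMajorant, coeff_mk]
    split_ifs with h
    · exact main i
    · rw [l1Norm_zero, mul_zero]
  have hKn : ∀ n, coeff n (majorant Q δ K) ≤ (Q + 1) * K ^ n := by
    intro n
    refine (coeff_majorant_le hq hδ1 hK0 n).trans (mul_le_mul_of_nonneg_left ?_ (by positivity))
    rw [coeff_geomSeries]
    exact mul_le_of_le_one_right (by positivity)
      (inv_le_one_of_one_le₀ (one_le_pow₀ (by linarith [(Nat.cast_nonneg n : (0 : ℝ) ≤ n)])))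
  refine ⟨Q + 1, K, by positivity, hK, fun n => ?_⟩
  cases n with
  | zero =>
    simp only [pow_zero, mul_one, Nat.factorial_zero, Nat.cast_one, one_pow]
    refine ⟨?_, ?_, by linarith⟩
    · rw [solW, l1Norm_zero]; positivity
    · rw [solB, norm_one]; linarith
  | succ n =>
    obtain ⟨h1, h2, h3⟩ := step n (hdom n)
    have h4 := mul_le_mul_of_nonneg_left (hKn (n + 1))
      (show (0 : ℝ) ≤ ((n + 1).factorial : ℝ) ^ σ by positivity)
    rw [mul_comm] at h4
    rw [mul_comm (((n + 1).factorial : ℝ) ^ σ)] at h1 h2 h3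
    rw [mul_comm (((n + 1).factorial : ℝ) ^ σ)] at h4
    exact ⟨h1.trans h4, h2.trans h4, h3.trans h4⟩

/-- The weight grows polynomially in n and 1 + (2n + 1)² ≤ 2 · 9ⁿ, so the change of norm only
enlarges the geometric rate. -/
lemma hNorm_toFourier_le_of_orderLE {s : ℝ} (hs : 0 ≤ s) {n : ℕ} {a : TrigPoly Q}
    (ha : OrderLE (2 * n + 1) a) :
    hNorm Q s (toFourier a) ≤ 2 ^ (s / 2) * ((9 : ℝ) ^ (s / 2)) ^ n * l1Norm a := by
  refine (hNorm_toFourier_le hs ha).trans (mul_le_mul_of_nonneg_right ?_ (l1Norm_nonneg a))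
  rw [← Real.rpow_mul_natCast (by norm_num), mul_comm (s / 2), Real.rpow_natCast_mul (by norm_num),
    ← Real.mul_rpow (by norm_num) (by positivity)]
  refine Real.rpow_le_rpow (by positivity) ?_ (by positivity)
  have h : ∀ n : ℕ, 1 + (2 * (n : ℝ) + 1) ^ 2 ≤ 2 * 9 ^ n := by
    intro n
    induction n with
    | zero => norm_num
    | succ n ih =>
      have : (0 : ℝ) ≤ n := Nat.cast_nonneg n
      rw [pow_succ (9 : ℝ)]
      push_cast
      nlinarith
  exact_mod_cast h n

/-- Gevrey estimates in the norm of `H_s`. -/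
lemma exists_hNorm_le [NeZero Q] (hQ : 2 < Q) {s : ℝ} (hs : 0 ≤ s) : ∃ A K : ℝ, 0 < A ∧ 0 < K ∧
    ∀ n, hNorm Q s (toFourier (solW Q n)) ≤ A * K ^ n * (n.factorial : ℝ) ^ (4 * ell Q) ∧
      ‖solB Q n‖ ≤ A * K ^ n * (n.factorial : ℝ) ^ (4 * ell Q) ∧
      hNorm Q s (toFourier (coeff n (solU Q))) ≤
        A * K ^ n * (n.factorial : ℝ) ^ (4 * ell Q) := by
  obtain ⟨A, K, hA, hK, h⟩ := exists_l1Norm_le hQ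
  have h2 : (1 : ℝ) ≤ 2 ^ (s / 2) := Real.one_le_rpow (by norm_num) (by positivity)
  have h9 : (1 : ℝ) ≤ 9 ^ (s / 2) := Real.one_le_rpow (by norm_num) (by positivity)
  refine ⟨2 ^ (s / 2) * A, 9 ^ (s / 2) * K, by positivity, by positivity, fun n => ?_⟩
  obtain ⟨h3, h4, h5⟩ := h n
  have hc : 2 ^ (s / 2) * ((9 : ℝ) ^ (s / 2)) ^ n * (A * K ^ n * (n.factorial : ℝ) ^ (4 * ell Q)) =
      2 ^ (s / 2) * A * (9 ^ (s / 2) * K) ^ n * (n.factorial : ℝ) ^ (4 * ell Q) := by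
    rw [mul_pow]; ring
  have hc0 : (0 : ℝ) ≤ 2 ^ (s / 2) * ((9 : ℝ) ^ (s / 2)) ^ n := by positivity
  rw [← hc]
  refine ⟨(hNorm_toFourier_le_of_orderLE hs (orderLE_solW n)).trans
    (mul_le_mul_of_nonneg_left h3 hc0), ?_, (hNorm_toFourier_le_of_orderLE hs
    (orderLE_coeff_solU n)).trans (mul_le_mul_of_nonneg_left h5 hc0)⟩
  exact h4.trans (le_mul_of_one_le_left (by positivity)
    (one_le_mul_of_one_le_of_one_le h2 (one_le_pow₀ h9)))

end Gevrey

end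

end Quasipattern

/-! ### Existence, uniqueness and estimates combined -/

open Quasipattern in
theorem theorem1 (Q : ℕ) (hQ : 8 ≤ Q) (hQeven : Even Q) (s : ℝ) (hs : (Q : ℝ) / 4 < s) :
    ∃ (U W : ℕ → Quasipattern.FourierSeries Q) (b : ℕ → ℝ),
      -- the formal solution exists, in the stated form
      U 0 = Quasipattern.leading Q ∧
      Quasipattern.IsQuasipatternSolution Q s (Quasipattern.amplitudeSeries U) ∧
      (∀ n, Quasipattern.MemH Q s (U n)) ∧
      (∀ n, Quasipattern.RotInvariant (U n)) ∧
      (∀ n, Quasipattern.IsRealValued (U n)) ∧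
      -- it is unique
      (∀ V : Quasipattern.FormalSeries Q, Quasipattern.IsQuasipatternSolution Q s V →
        V = Quasipattern.amplitudeSeries U) ∧
      -- decomposition of the coefficients
      (∀ n, U n = (b n : ℂ) • Quasipattern.leading Q + W n) ∧
      (∀ n, Quasipattern.MemH Q s (W n)) ∧
      (∀ n, ∀ j : Fin Q, Quasipattern.hInner Q s (W n) (Quasipattern.mode Q j) = 0) ∧
      -- Gevrey estimates
      (∃ c : ℝ, Quasipattern.IsAlgebraConst Q s c) ∧
      ∀ c : ℝ, Quasipattern.IsAlgebraConst Q s c →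
        ∃ δ : ℝ, 0 < δ ∧ ∃ γ : ℝ, 0 < γ ∧ ∃ K : ℝ, 0 < K ∧
          (∀ n : ℕ, 1 ≤ n → Quasipattern.hNorm Q s (W n) ≤
            δ * (((Q : ℝ) - 1) / ((2 : ℝ) ^ (s / 2) * c ^ 2 * (Q : ℝ)))
              * K ^ n * (n.factorial : ℝ) ^ (4 * Quasipattern.ell Q)) ∧
          (∀ n : ℕ, 1 ≤ n → |b n| ≤
            δ * K ^ n * (n.factorial : ℝ) ^ (4 * Quasipattern.ell Q)) ∧
          (∀ n : ℕ, Quasipattern.hNorm Q s (U n) ≤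
            γ * K ^ n * (n.factorial : ℝ) ^ (4 * Quasipattern.ell Q)) := by
  have hQ2 : 2 < Q := by omega
  have hQ1 : 1 < Q := by omega
  have : NeZero Q := ⟨by omega⟩
  have hs0 : 0 ≤ s := (lt_of_le_of_lt (by positivity) hs).le
  have hB : ∀ n, (((solB Q n).re : ℝ) : ℂ) = solB Q n := fun n =>
    Complex.conj_eq_iff_re.1 (conjHom_solW_and_conj_solB n).2
  refine ⟨fun n => toFourier (PowerSeries.coeff n (solU Q)), fun n => toFourier (solW Q n),
    fun n => (solB Q n).re, ?_, ?_, fun n => memH_toFourier _, rotInvariant_coeff_solU,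
    isRealValued_coeff_solU hQeven, fun V hV => ?_, fun n => ?_, fun n => memH_toFourier _,
    fun n j => hInner_mode_eq_zero (coeff_solW_wave n j), exists_isAlgebraConst hQeven hs,
    fun c hc => ?_⟩
  · beta_reduce
    rw [coeff_zero_solU, toFourier_leadingPoly]
  · rw [amplitudeSeries_eq]
    exact (isQuasipatternSolution_toFourier_iff _).2 (isPolySolution_halfSol hQeven hQ1)
  -- An arbitrary solution is lifted to trigonometric polynomials, where uniqueness is known.
  · choose w hw using fun m =>
      exists_toFourier_eq (finite_support_of_isFormalSolution hQeven hV.zero hV.sol m)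
    have hVw : V = fun m => toFourier (PowerSeries.coeff m (PowerSeries.mk w)) := by
      funext m
      rw [PowerSeries.coeff_mk, hw]
    rw [hVw] at hV
    rw [hVw, amplitudeSeries_eq, ((isQuasipatternSolution_toFourier_iff _).1 hV).unique hQeven hQ1
      (isPolySolution_halfSol hQeven hQ1)]
  · beta_reduce
    rw [hB, coeff_solU, map_add, map_smul, toFourier_leadingPoly]
  · obtain ⟨A, K, hA, hK, h⟩ := exists_hNorm_le hQ2 hs0
    have hQ' : (1 : ℝ) < Q := mod_cast hQ1
    have hc0 := hc.1
    set r : ℝ := ((Q : ℝ) - 1) / (2 ^ (s / 2) * c ^ 2 * Q) with hr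
    have hr0 : 0 < r := div_pos (by linarith) (by positivity)
    -- The factor r, the only place where c enters, is absorbed into δ; γ and K do not depend on c.
    refine ⟨max A (A / r), lt_max_of_lt_left hA, A, hA, K, hK, fun n _ => ?_, fun n _ => ?_,
      fun n => (h n).2.2⟩
    · refine (h n).1.trans ?_
      have h1 : A ≤ max A (A / r) * r := by
        rw [← div_le_iff₀ hr0]
        exact le_max_right _ _
      gcongr
    · rw [← Real.norm_eq_abs, ← Complex.norm_real, hB]
      refine (h n).2.1.trans ?_
      gcongr
      exact le_max_left _ _
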